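/- Let $(X,\mathcal B,\mu)$ be a standard non-atomic probability space. An automorphism is an invertible bimeasurable $\mu$-preserving transformation; automorphisms that agree almost everywhere are identified. The group $\mathrm{Aut}(\mu\otimes\mu)$ carries the Halmos metric $$\rho(S,T)=\sum_i 2^{-i}\big((\mu\otimes\mu)(SD_i\,\triangle\,TD_i)+(\mu\otimes\mu)(S^{-1}D_i\,\triangle\,T^{-1}D_i)\big),$$ where $\{D_i\}$ is a fixed sequence of measurable sets that is dense in the measure algebra of $\mu\otimes\mu$. Let $\mathrm{Ext}(\mathrm{Id})\subset \mathrm{Aut}(\mu\otimes\mu)$ be the space, with the induced topology, of the extensions of the identity, i.e. of the skew products $(\mathrm{Id},T_x):(x,y)\mapsto(x,T_xy)$ on $X\times X$, where $\{T_x\}_{x\in X}$ is a measurable family of automorphisms of $(X,\mu)$. A property holds for a generic extension of the identity if it holds for all elements of some dense $G_\delta$ subset of $\mathrm{Ext}(\mathrm{Id})$. An automorphism $T$ of $(X,\mu)$ also denotes the unitary operator $f\mapsto f\circ T$ on $L^2(\mu)$, and $\Theta$ denotes the orthogonal projection of $L^2(\mu)$ onto the constants. An admissible function is an expression $P(T)=c\,\Theta+\sum_{i=0}^\infty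 c_iT^i$ with $c,c_i\ge 0$ and $c+\sum_{i=0}^\infty c_i=1$. Theorem. Let $X=\bigsqcup_m A_m$ be a finite or countable partition of $X$ into measurable sets of positive measure, let $P_m$ be an admissible function for each $m$, and let $n_j$ be a sequence of natural numbers with $n_j\to\infty$. Then for a generic extension $(\mathrm{Id},T_x)$ of the identity there is a subsequence $n_{j(k)}$, with $j(1)<j(2)<\dots$, such that for each $m$ and for almost every $x\in A_m$ $$T_x^{\,n_{j(k)}}\longrightarrow P_m(T_x)\qquad (k\to\infty)$$ in the weak operator topology of $L^2(\mu)$. -/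

import Mathlib

open MeasureTheory Filter Topology
open scoped symmDiff ENNReal

namespace TypicalExt

noncomputable section

section Automorphisms

variable {α : Type*} [MeasurableSpace α]

/-- An invertible, bimeasurable, measure-preserving transformation of `(α, μ)`. -/
structure Transformation (μ : Measure α) where
  toEquiv : α ≃ᵐ α
  measurePreserving : MeasurePreserving toEquiv μ μ

/-- The identity transformation. -/
def Transformation.id (μ : Measure α) : Transformation μ :=
  ⟨MeasurableEquiv.refl α, MeasurePreserving.id μ⟩

/-- Transformations are identified when they coincide almost everywhere. -/
instance Transformation.setoid (μ : Measure α) : Setoid (Transformation μ) where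
  r S T := ∀ᵐ x ∂μ, S.toEquiv x = T.toEquiv x
  iseqv :=
    { refl := fun _ => Eventually.of_forall fun _ => rfl
      symm := fun h => h.mono fun _ hx => hx.symm
      trans := fun h₁ h₂ => by
        filter_upwards [h₁, h₂] with x hx₁ hx₂ using hx₁.trans hx₂ }

/-- The space `Aut(μ)` of automorphisms of the measure space `(α, μ)`: invertible
measure-preserving transformations modulo equality almost everywhere. -/
def Aut (μ : Measure α) : Type _ := Quotient (Transformation.setoid μ)

/-- The automorphism determined by a transformation. -/
def Transformation.toAut {μ : Measure α} (T : Transformation μ) : Aut μ :=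
  Quotient.mk (Transformation.setoid μ) T

/-- The `i`-th term of Halmos' distance, without its weight:
`μ(S Dᵢ ∆ T Dᵢ) + μ(S⁻¹ Dᵢ ∆ T⁻¹ Dᵢ)`. -/
def halmosTerm {μ : Measure α} (D : ℕ → Set α) (i : ℕ) (S T : Transformation μ) : ℝ :=
  μ.real ((S.toEquiv '' D i) ∆ (T.toEquiv '' D i)) +
    μ.real ((S.toEquiv ⁻¹' D i) ∆ (T.toEquiv ⁻¹' D i))

/-- Halmos' distance
`ρ(S, T) = ∑ᵢ 2⁻ⁱ (μ(S Dᵢ ∆ T Dᵢ) + μ(S⁻¹ Dᵢ ∆ T⁻¹ Dᵢ))` between transformations. -/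
def halmosPreDist {μ : Measure α} (D : ℕ → Set α) (S T : Transformation μ) : ℝ :=
  ∑' i : ℕ, (1 / 2 : ℝ) ^ i * halmosTerm D i S T

theorem ae_symm_eq {μ : Measure α} {S T : Transformation μ}
    (h : ∀ᵐ x ∂μ, S.toEquiv x = T.toEquiv x) :
    ∀ᵐ x ∂μ, S.toEquiv.symm x = T.toEquiv.symm x := by
  have hT : MeasurePreserving T.toEquiv.symm μ μ := T.measurePreserving.symm T.toEquiv
  have := hT.quasiMeasurePreserving.ae h
  filter_upwards [this] with x hx
  rw [MeasurableEquiv.apply_symm_apply] at hx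
  rw [← hx, MeasurableEquiv.symm_apply_apply, hx]

theorem halmosTerm_congr {μ : Measure α} (D : ℕ → Set α) (i : ℕ)
    {S S' T T' : Transformation μ} (hS : S ≈ S') (hT : T ≈ T') :
    halmosTerm D i S T = halmosTerm D i S' T' := by
  have hS1 : ∀ᵐ x ∂μ, S.toEquiv x = S'.toEquiv x := hS
  have hT1 : ∀ᵐ x ∂μ, T.toEquiv x = T'.toEquiv x := hT
  have hS2 := ae_symm_eq hS1
  have hT2 := ae_symm_eq hT1
  unfold halmosTerm
  congr 1
  · simp only [MeasurableEquiv.image_eq_preimage_symm]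
    apply measureReal_congr
    filter_upwards [hS2, hT2] with x h1 h2
    exact propext (by
      change (x ∈ (S.toEquiv.symm ⁻¹' D i) ∆ (T.toEquiv.symm ⁻¹' D i)) ↔
        (x ∈ (S'.toEquiv.symm ⁻¹' D i) ∆ (T'.toEquiv.symm ⁻¹' D i))
      simp only [Set.mem_symmDiff, Set.mem_preimage, h1, h2])
  · apply measureReal_congr
    filter_upwards [hS1, hT1] with x h1 h2
    exact propext (by
      change (x ∈ (S.toEquiv ⁻¹' D i) ∆ (T.toEquiv ⁻¹' D i)) ↔
        (x ∈ (S'.toEquiv ⁻¹' D i) ∆ (T'.toEquiv ⁻¹' D i))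
      simp only [Set.mem_symmDiff, Set.mem_preimage, h1, h2])

/-- Halmos' distance on `Aut(μ)`. -/
def halmosDist {μ : Measure α} (D : ℕ → Set α) : Aut μ → Aut μ → ℝ :=
  Quotient.lift₂ (halmosPreDist D) fun S T S' T' hS hT => by
    unfold halmosPreDist
    exact tsum_congr fun i => by rw [halmosTerm_congr D i hS hT]

theorem halmosTerm_nonneg {μ : Measure α} (D : ℕ → Set α) (i : ℕ) (S T : Transformation μ) :
    0 ≤ halmosTerm D i S T := by
  unfold halmosTerm
  positivity

theorem summable_halmos {μ : Measure α} [IsFiniteMeasure μ] (D : ℕ → Set α)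
    (S T : Transformation μ) :
    Summable fun i : ℕ => (1 / 2 : ℝ) ^ i * halmosTerm D i S T := by
  refine Summable.of_nonneg_of_le
    (fun i => mul_nonneg (by positivity) (halmosTerm_nonneg D i S T)) (fun i => ?_)
    (summable_geometric_two.mul_right (μ.real Set.univ + μ.real Set.univ))
  refine mul_le_mul_of_nonneg_left ?_ (by positivity)
  exact add_le_add (measureReal_mono (Set.subset_univ _)) (measureReal_mono (Set.subset_univ _))

/-- `Aut(μ)` with Halmos' metric of the family `D`. -/
@[reducible] def halmosMetric {μ : Measure α} [IsFiniteMeasure μ] (D : ℕ → Set α) :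
    PseudoMetricSpace (Aut μ) where
  dist := halmosDist D
  dist_self R := by
    induction R using Quotient.inductionOn with
    | h S => simp [halmosDist, halmosPreDist, halmosTerm]
  dist_comm R R' := by
    induction R, R' using Quotient.inductionOn₂ with
    | h S T =>
      change halmosPreDist D S T = halmosPreDist D T S
      simp only [halmosPreDist, halmosTerm, symmDiff_comm]
  dist_triangle R R' R'' := by
    induction R, R', R'' using Quotient.inductionOn₃ with
    | h S T U =>
      change halmosPreDist D S U ≤ halmosPreDist D S T + halmosPreDist D T U
      unfold halmosPreDist
      rw [← (summable_halmos D S T).tsum_add (summable_halmos D T U)]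
      refine (summable_halmos D S U).tsum_le_tsum (fun i => ?_)
        ((summable_halmos D S T).add (summable_halmos D T U))
      rw [← mul_add]
      refine mul_le_mul_of_nonneg_left ?_ (by positivity)
      unfold halmosTerm
      have h1 := measureReal_symmDiff_le (μ := μ) (s := S.toEquiv '' D i)
        (t := T.toEquiv '' D i) (U.toEquiv '' D i)
      have h2 := measureReal_symmDiff_le (μ := μ) (s := S.toEquiv ⁻¹' D i)
        (t := T.toEquiv ⁻¹' D i) (U.toEquiv ⁻¹' D i)
      linarith

end Automorphisms

section Extensions

variable {X : Type*} [MeasurableSpace X]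

/-- A measurable family `{T_x}` of invertible measure-preserving transformations of `(X, μ)`,
indexed by the points of `X`. -/
structure MeasurableFamily (μ : Measure X) where
  fiber : X → Transformation μ
  measurable_fiber : Measurable fun p : X × X => (fiber p.1).toEquiv p.2
  measurable_fiber_symm : Measurable fun p : X × X => (fiber p.1).toEquiv.symm p.2

/-- The skew product `(x, y) ↦ (S x, T_x y)` on `(X × X, μ ⊗ μ)`. -/
def skewProduct {μ : Measure X} [SFinite μ] (S : Transformation μ) (T : MeasurableFamily μ) :
    Transformation (μ.prod μ) where
  toEquiv :=
    { toFun := fun p => (S.toEquiv p.1, (T.fiber p.1).toEquiv p.2)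
      invFun := fun p =>
        (S.toEquiv.symm p.1, (T.fiber (S.toEquiv.symm p.1)).toEquiv.symm p.2)
      left_inv := fun p => by simp
      right_inv := fun p => by simp
      measurable_toFun := (S.toEquiv.measurable.comp measurable_fst).prodMk T.measurable_fiber
      measurable_invFun :=
        (S.toEquiv.symm.measurable.comp measurable_fst).prodMk
          (T.measurable_fiber_symm.comp
            ((S.toEquiv.symm.measurable.comp measurable_fst).prodMk measurable_snd)) }
  measurePreserving :=
    S.measurePreserving.skew_product (g := fun x y => (T.fiber x).toEquiv y)
      T.measurable_fiber
      (Eventually.of_forall fun x => (T.fiber x).measurePreserving.map_eq)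

/-- The set `Ext(S) ⊆ Aut(μ ⊗ μ)` of the extensions of `S`, that is, of the automorphisms
given by skew products over `S`. -/
def Ext {μ : Measure X} [SFinite μ] (S : Transformation μ) : Set (Aut (μ.prod μ)) :=
  Set.range fun T : MeasurableFamily μ => (skewProduct S T).toAut

/-- The extension `(S, T_x)` as a point of `Ext(S)`. -/
def toExt {μ : Measure X} [SFinite μ] (S : Transformation μ) (T : MeasurableFamily μ) :
    Ext S :=
  ⟨(skewProduct S T).toAut, T, rfl⟩

/-- The property `p` holds for the typical (generic) extension `(S, T_x)`: all extensions in
some dense `G_δ` subset of the space `Ext(S)`, with the topology induced by Halmos' metric of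
the family `D` on `Aut(μ ⊗ μ)`, have it. -/
def ForTypicalExtension {μ : Measure X} [IsFiniteMeasure μ] (D : ℕ → Set (X × X))
    (S : Transformation μ) (p : MeasurableFamily μ → Prop) : Prop :=
  letI : PseudoMetricSpace (Aut (μ.prod μ)) := halmosMetric D
  ∃ G : Set (Ext S), IsGδ G ∧ Dense G ∧ ∀ T : MeasurableFamily μ, toExt S T ∈ G → p T

end Extensions

section Operators

variable {X : Type*} [MeasurableSpace X]

/-- The unitary operator `f ↦ f ∘ T` on `L²(μ)`. -/
def koopman {μ : Measure X} (T : Transformation μ) : Lp ℂ 2 μ →L[ℂ] Lp ℂ 2 μ :=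
  (Lp.compMeasurePreservingₗᵢ ℂ T.toEquiv T.measurePreserving).toContinuousLinearMap

/-- The orthogonal projection `Θ` of `L²(μ)` onto the space of constants. -/
def projConst (μ : Measure X) [IsFiniteMeasure μ] : Lp ℂ 2 μ →L[ℂ] Lp ℂ 2 μ :=
  (Submodule.span ℂ {Lp.const 2 μ (1 : ℂ)}).starProjection

/-- Coefficients of an admissible function `P(T) = c Θ + ∑ᵢ cᵢ Tⁱ`:
`c, cᵢ ≥ 0` and `c + ∑ᵢ cᵢ = 1`. -/
structure AdmissibleFunction where
  c : ℝ
  coeff : ℕ → ℝ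
  c_nonneg : 0 ≤ c
  coeff_nonneg : ∀ i, 0 ≤ coeff i
  hasSum_coeff : HasSum coeff (1 - c)

/-- The operator `P(U) = c Θ + ∑ᵢ cᵢ Uⁱ`, the series being taken in the operator norm. -/
def AdmissibleFunction.eval (P : AdmissibleFunction) {μ : Measure X} [IsFiniteMeasure μ]
    (U : Lp ℂ 2 μ →L[ℂ] Lp ℂ 2 μ) : Lp ℂ 2 μ →L[ℂ] Lp ℂ 2 μ :=
  (P.c : ℂ) • projConst μ + ∑' i : ℕ, (P.coeff i : ℂ) • U ^ i

/-- The series in the definition of `P(U)` converges when `U = koopman T`. -/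
theorem AdmissibleFunction.summable (P : AdmissibleFunction) {μ : Measure X}
    (T : Transformation μ) : Summable fun i : ℕ => (P.coeff i : ℂ) • koopman T ^ i := by
  refine Summable.of_norm_bounded P.hasSum_coeff.summable fun i => ?_
  have h1 : ‖koopman T ^ i‖ ≤ 1 := by
    refine ContinuousLinearMap.opNorm_le_bound _ zero_le_one fun f => ?_
    rw [one_mul]
    induction i generalizing f with
    | zero => simp
    | succ i ih =>
      rw [pow_succ, mul_apply_eq_comp]
      exact (ih _).trans_eq
        ((Lp.compMeasurePreservingₗᵢ ℂ T.toEquiv T.measurePreserving).norm_map f)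
  rw [norm_smul, Complex.norm_real, Real.norm_of_nonneg (P.coeff_nonneg i)]
  exact mul_le_of_le_one_right (P.coeff_nonneg i) h1

/-- Weak convergence of a sequence of operators on `L²(μ)`. -/
def WeaklyConverges {μ : Measure X} (A : ℕ → Lp ℂ 2 μ →L[ℂ] Lp ℂ 2 μ)
    (B : Lp ℂ 2 μ →L[ℂ] Lp ℂ 2 μ) : Prop :=
  ∀ f g : Lp ℂ 2 μ, Tendsto (fun k => inner ℂ (A k f) g) atTop (𝓝 (inner ℂ (B f) g))

end Operators

end

end TypicalExt

/-! The proof is a Baire category argument in the space of extensions of the identity, which is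
complete for Halmos' metric (`completeSpace_ext_id`). Fix a sequence `E a` dense in the measure
algebra of `μ`. For an extension, `deviation` measures at each `x` how far `μ(T_x⁻ⁿ E ∩ F)` is from
the matrix coefficient of `P_m(T_x)` at the two indicators, where `m` is the cell of `x`. The
integral of the deviation over `x` is continuous on the space (`tendsto_integral_deviation`), so it
is an open condition that for some `j ≥ k` all these integrals at time `n j` with `a, b < k` are
below `2⁻ᵏ`. If these conditions are also dense, their intersection over `k` is a dense `G_δ`. On it
the integrals are summable along a subsequence, so almost every fibre has convergent matrix
coefficients on a countable dense family; uniform operator bounds extend this to `L²`.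

The substance is density. For a single transformation `R`, finitely many sets and any large `n`, one
needs `Q` close to `R` on these sets whose power `Qⁿ` correlates them almost as `P(Q)` does
(`exists_transformation_near_correlation`). Take a union of finite cycles: one of length `2n` with
total weight `c`, and one of length `n - i` with weight `cᵢ` for each small `i`. Cut the cycles into
blocks of length `M` and let each block display an orbit piece of `R` started at its own independent
random point. Rotating the cycles looks like one application of `R` except at the rare block ends.
Yet `n` rotations amount to `i` rotations on the cycle of length `n - i`, and on the long cycle they
lead to an independent block, which produces `Θ`. The model is carried to `X` by an isomorphism of
atomless standard spaces that respects the finitely many sets (`exists_ae_isomorphism_of_label`).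

For a family, the points `x` are sorted by countably many labels recording the cell and
approximations of the sections involved. Finitely many labels cover almost all of `X`, and one `Q`
per label suffices (`exists_near_family_deviation_le`). -/

namespace TypicalExt

/-! ### Invertible transformations from pairs of maps inverse almost everywhere -/

section AeInverse

variable {α : Type*} [MeasurableSpace α] [MeasurableEq α]

-- Keep the maps on the set `I` of points whose `f`- and `g`-orbits stay where the two maps invert
-- each other, and use the identity elsewhere. `I` is invariant under both maps and has full measure
-- because iterates preserve `μ`. The pointwise alternatives in the conclusion let an everywhere
-- property, such as fixing the first coordinate, survive the correction.
open Classical in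
theorem exists_transformation_of_ae_inverse {μ : Measure α} {f g : α → α}
    (hf : MeasurePreserving f μ μ) (hg : MeasurePreserving g μ μ)
    (hgf : ∀ᵐ p ∂μ, g (f p) = p) (hfg : ∀ᵐ p ∂μ, f (g p) = p) :
    ∃ T : Transformation μ, (∀ᵐ p ∂μ, T.toEquiv p = f p) ∧ (∀ᵐ p ∂μ, T.toEquiv.symm p = g p) ∧
      (∀ p, T.toEquiv p = f p ∨ T.toEquiv p = p) ∧
      (∀ p, T.toEquiv.symm p = g p ∨ T.toEquiv.symm p = p) := by
  set B : Set α := {p | g (f p) = p ∧ f (g p) = p} with hB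
  set I : Set α := {p | ∀ k : ℕ, f^[k] p ∈ B ∧ g^[k] p ∈ B} with hI
  have hBm : MeasurableSet B :=
    (measurableSet_eq_fun (hg.measurable.comp hf.measurable) measurable_id).inter
      (measurableSet_eq_fun (hf.measurable.comp hg.measurable) measurable_id)
  have hIm : MeasurableSet I := by
    have : I = ⋂ k : ℕ, (f^[k] ⁻¹' B ∩ g^[k] ⁻¹' B) := by
      ext p; simp [hI]
    rw [this]
    exact MeasurableSet.iInter fun k =>
      (hf.measurable.iterate k hBm).inter (hg.measurable.iterate k hBm)
  have hBae : ∀ᵐ p ∂μ, p ∈ B := by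
    filter_upwards [hgf, hfg] with p h1 h2 using ⟨h1, h2⟩
  have hIae : ∀ᵐ p ∂μ, p ∈ I := by
    refine ae_all_iff.2 fun k => ?_
    filter_upwards [(hf.iterate k).quasiMeasurePreserving.ae hBae,
      (hg.iterate k).quasiMeasurePreserving.ae hBae] with p h1 h2 using ⟨h1, h2⟩
  have hfI : ∀ p ∈ I, f p ∈ I := by
    intro p hp k
    refine ⟨by simpa using (hp (k + 1)).1, ?_⟩
    cases k with
    | zero => simpa using (hp 1).1
    | succ k =>
      rw [Function.iterate_succ_apply, show g (f p) = p from (hp 0).1.1]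
      exact (hp k).2
  have hgI : ∀ p ∈ I, g p ∈ I := by
    intro p hp k
    refine ⟨?_, by simpa using (hp (k + 1)).2⟩
    cases k with
    | zero => simpa using (hp 1).2
    | succ k =>
      rw [Function.iterate_succ_apply, show f (g p) = p from (hp 0).1.2]
      exact (hp k).1
  let F : α → α := fun p => if p ∈ I then f p else p
  let G : α → α := fun p => if p ∈ I then g p else p
  have hF : ∀ᵐ p ∂μ, F p = f p := hIae.mono fun p hp => if_pos hp
  have hG : ∀ᵐ p ∂μ, G p = g p := hIae.mono fun p hp => if_pos hp
  have hFm : Measurable F := Measurable.ite hIm hf.measurable measurable_id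
  have hGm : Measurable G := Measurable.ite hIm hg.measurable measurable_id
  refine ⟨⟨⟨⟨F, G, fun p => ?_, fun p => ?_⟩, hFm, hGm⟩, hFm, ?_⟩, hF, hG, fun p => ?_, fun p => ?_⟩
  · by_cases hp : p ∈ I
    · have := (hp 0).1.1
      simp only [Function.iterate_zero, id] at this
      simp [F, G, hp, hfI p hp, this]
    · simp [F, G, hp]
  · by_cases hp : p ∈ I
    · have := (hp 0).1.2
      simp only [Function.iterate_zero, id] at this
      simp [F, G, hp, hgI p hp, this]
    · simp [F, G, hp]
  · exact (Measure.map_congr hF).trans hf.map_eq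
  · change F p = f p ∨ F p = p
    by_cases hp : p ∈ I <;> simp [F, hp]
  · change G p = g p ∨ G p = p
    by_cases hp : p ∈ I <;> simp [G, hp]

end AeInverse

/-! ### Gluing over the fibres of a countable label -/

section Fiber

variable {Y X L : Type*} [MeasurableSpace Y] [MeasurableSpace X] [Countable L]
  [MeasurableSpace L] [MeasurableSingletonClass L]


theorem ae_of_ae_restrict_fiber {ν : Measure Y} {a : Y → L} (ha : Measurable a) {p : Y → Prop}
    (hp : ∀ l, ∀ᵐ y ∂(ν.restrict (a ⁻¹' {l})), a y = l → p y) : ∀ᵐ y ∂ν, p y := by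
  have : ∀ᵐ y ∂ν, ∀ l, a y = l → p y := ae_all_iff.2 fun l => by
    filter_upwards [(ae_restrict_iff' (ha (measurableSet_singleton l))).1 (hp l)] with y hy hyl
      using hy hyl hyl
  filter_upwards [this] with y hy using hy _ rfl

theorem measure_eq_tsum_fiber (ν : Measure Y) {a : Y → L} (ha : Measurable a) {s : Set Y}
    (hs : MeasurableSet s) : ν s = ∑' l, ν (s ∩ a ⁻¹' {l}) := by
  rw [← measure_iUnion]
  · congr 1
    ext z; simp
  · intro i j hij
    refine Disjoint.mono Set.inter_subset_right Set.inter_subset_right ?_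
    exact Disjoint.preimage a (by simpa using hij)
  · exact fun l => hs.inter (ha (measurableSet_singleton l))

theorem measurePreserving_of_fiber {ν : Measure Y} {μ : Measure X} {a : Y → L} {b : X → L}
    (ha : Measurable a) (hb : Measurable b) {J : L → Y → X}
    (hJ : ∀ l, MeasurePreserving (J l) (ν.restrict (a ⁻¹' {l})) (μ.restrict (b ⁻¹' {l}))) :
    MeasurePreserving (fun y => J (a y) y) ν μ := by
  have hm : Measurable fun y => J (a y) y := by
    have : Measurable fun p : Y × L => J p.2 p.1 :=
      measurable_from_prod_countable_left fun l => (hJ l).measurable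
    exact this.comp (measurable_id.prodMk ha)
  refine ⟨hm, ?_⟩
  ext s hs
  rw [Measure.map_apply hm hs, measure_eq_tsum_fiber ν ha (hm hs), measure_eq_tsum_fiber μ hb hs]
  refine tsum_congr fun l => ?_
  have h1 : (fun y => J (a y) y) ⁻¹' s ∩ a ⁻¹' {l} = J l ⁻¹' s ∩ a ⁻¹' {l} := by
    ext y
    simp only [Set.mem_inter_iff, Set.mem_preimage, Set.mem_singleton_iff]
    refine ⟨?_, ?_⟩ <;> · rintro ⟨h, rfl⟩; exact ⟨h, rfl⟩
  rw [h1, ← Measure.restrict_apply ((hJ l).measurable hs), (hJ l).measure_preimage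
    hs.nullMeasurableSet, Measure.restrict_apply hs]

end Fiber

/-! ### Isomorphism of atomless standard spaces, respecting labels -/

section Isomorphism

theorem continuous_measureReal_Iic (l : Measure ℝ) [IsFiniteMeasure l] [NullSingletonClass l] :
    Continuous fun t => l.real (Set.Iic t) := by
  rw [continuous_iff_continuousAt]
  intro t
  have h := IntegrableOn.continuousOn_Iic_primitive_Iic (μ := l) (f := fun _ => (1 : ℝ))
    (a₀ := t + 1) (integrable_const _).integrableOn
  have h2 := h.continuousAt (Iic_mem_nhds (lt_add_one t))
  simpa using h2

/-- A distribution function without jumps takes every intermediate value `u`, so `{F ≤ u}` is a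
half-line `Iic s` with `F s = u`, that is, of mass `u`. Comparison on half-lines suffices. -/
theorem map_measureReal_Iic (l : Measure ℝ) [IsFiniteMeasure l] [NullSingletonClass l] :
    l.map (fun t => l.real (Set.Iic t)) = volume.restrict (Set.Ioc 0 (l.real Set.univ)) := by
  set F : ℝ → ℝ := fun t => l.real (Set.Iic t) with hF
  set m := l.real Set.univ with hm
  have hmono : Monotone F := fun a b h => measureReal_mono (Set.Iic_subset_Iic.2 h)
  have hcont : Continuous F := continuous_measureReal_Iic l
  have hle : ∀ t, F t ≤ m := fun t => measureReal_mono (Set.subset_univ _)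
  have htop : Tendsto F atTop (𝓝 m) :=
    (ENNReal.tendsto_toReal (measure_ne_top _ _)).comp (tendsto_measure_Iic_atTop l)
  have hbot : Tendsto F atBot (𝓝 0) := by
    have h1 := (ENNReal.tendsto_toReal (measure_ne_top _ _)).comp (tendsto_measure_Ici_atBot l)
    have h2 : ∀ t, F t = m - (l (Set.Ici t)).toReal := fun t => by
      have h3 := measureReal_compl (μ := l) (measurableSet_Ici (a := t))
      rw [Set.compl_Ici, measureReal_congr Iio_ae_eq_Iic] at h3
      exact h3
    have h4 := h1.const_sub m
    rw [show m - (l Set.univ).toReal = 0 from sub_self _] at h4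
    exact h4.congr fun t => (h2 t).symm
  have key : ∀ u, 0 < u → u < m → l {t | F t ≤ u} = ENNReal.ofReal u := by
    intro u h0 hu
    have hne : {t | F t ≤ u}.Nonempty := ((hbot.eventually_lt_const h0).exists).imp fun _ h => h.le
    obtain ⟨b, hb⟩ := (htop.eventually_const_lt hu).exists
    have hbdd : BddAbove {t | F t ≤ u} := ⟨b, fun t ht => by
      by_contra! h
      exact absurd (hmono h.le) (not_le.2 (ht.trans_lt hb))⟩
    have hclosed : IsClosed {t | F t ≤ u} := isClosed_le hcont continuous_const
    set s := sSup {t | F t ≤ u} with hs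
    have hsmem : F s ≤ u := hclosed.csSup_mem hne hbdd
    have hset : {t | F t ≤ u} = Set.Iic s := by
      ext t
      exact ⟨fun h => le_csSup hbdd h, fun h => (hmono h).trans hsmem⟩
    have hge : u ≤ F s := by
      have hlim : Tendsto F (𝓝[>] s) (𝓝 (F s)) := (hcont.tendsto s).mono_left nhdsWithin_le_nhds
      refine ge_of_tendsto hlim ?_
      filter_upwards [self_mem_nhdsWithin] with t ht
      by_contra! h
      exact absurd (le_csSup hbdd (show t ∈ {t | F t ≤ u} from h.le)) (not_le.2 ht)
    rw [hset, ← le_antisymm hsmem hge, hF]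
    simp [measureReal_def]
  have : IsFiniteMeasure (l.map F) := inferInstance
  refine Measure.ext_of_Iic _ _ fun u => ?_
  rw [Measure.map_apply hcont.measurable measurableSet_Iic,
    Measure.restrict_apply measurableSet_Iic]
  change l {t | F t ≤ u} = _
  rcases lt_or_ge u 0 with hu | hu
  · have h1 : {t | F t ≤ u} = ∅ := by
      ext t; simp only [Set.mem_ofPred_eq, Set.mem_empty_iff_false, iff_false, not_le]
      exact hu.trans_le measureReal_nonneg
    have h2 : Set.Iic u ∩ Set.Ioc 0 m = ∅ := by
      ext t; simp only [Set.mem_inter_iff, Set.mem_Iic, Set.mem_Ioc, Set.mem_empty_iff_false,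
        iff_false]
      rintro ⟨a, b, c⟩; linarith
    simp [h1, h2]
  rcases le_or_gt m u with hmu | hmu
  · have h1 : {t | F t ≤ u} = Set.univ := Set.eq_univ_of_forall fun t => (hle t).trans hmu
    have h2 : Set.Iic u ∩ Set.Ioc 0 m = Set.Ioc 0 m :=
      Set.inter_eq_right.2 fun t ht => ht.2.trans hmu
    rw [h1, h2, Real.volume_Ioc, sub_zero, hm]
    simp [measureReal_def]
  · have h2 : Set.Iic u ∩ Set.Ioc 0 m = Set.Ioc 0 u := by
      ext t; simp only [Set.mem_inter_iff, Set.mem_Iic, Set.mem_Ioc]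
      constructor
      · rintro ⟨a, b, c⟩; exact ⟨b, a⟩
      · rintro ⟨a, b⟩; exact ⟨b, a, b.trans hmu.le⟩
    rw [h2, Real.volume_Ioc, sub_zero]
    rcases hu.eq_or_lt with rfl | hu'
    -- At height `0` the sublevel set may be empty and have no supremum; its mass is squeezed by the
    -- heights `v ↓ 0`.
    · rw [ENNReal.ofReal_zero, ← nonpos_iff_eq_zero]
      have hlim : Tendsto (fun u => ENNReal.ofReal u) (𝓝[>] (0 : ℝ)) (𝓝 0) := by
        simpa using (ENNReal.continuous_ofReal.tendsto 0).mono_left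
          (nhdsWithin_le_nhds (s := Set.Ioi (0 : ℝ)))
      refine ge_of_tendsto hlim ?_
      filter_upwards [Ioo_mem_nhdsGT hmu] with v hv
      rw [← key v hv.1 hv.2]
      exact measure_mono fun t ht => le_trans ht hv.1.le
    · exact key u hu' hmu

/-- After embedding `Y` in the line, the distribution function fails to be injective only on its
flat stretches. Each contains a rational, so they lie in the countably many level sets making up
`N`, which are null since the image measure has no atoms. Off `N` the map is an injective measurable
map of standard spaces, hence a measurable embedding with a measurable left inverse. -/
theorem exists_ae_injective_map_eq_volume {Y : Type*} [MeasurableSpace Y] [StandardBorelSpace Y]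
    [Nonempty Y] (ν : Measure Y) [IsFiniteMeasure ν] [NullSingletonClass ν] :
    ∃ (F : Y → ℝ) (G : ℝ → Y), Measurable F ∧ Measurable G ∧
      ν.map F = volume.restrict (Set.Ioc 0 (ν.real Set.univ)) ∧ ∀ᵐ y ∂ν, G (F y) = y := by
  obtain ⟨e, he⟩ := exists_measurableEmbedding_real Y
  set l := ν.map e with hl
  have : IsFiniteMeasure l := inferInstance
  have : NullSingletonClass l := ⟨fun t => by
    rw [hl, he.map_apply]
    have : (e ⁻¹' {t}).Subsingleton := fun a ha b hb => he.injective (ha.trans hb.symm)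
    exact this.measure_zero ν⟩
  set F : ℝ → ℝ := fun t => l.real (Set.Iic t) with hF
  have hmono : Monotone F := fun a b h => measureReal_mono (Set.Iic_subset_Iic.2 h)
  have hmap : l.map F = _ := map_measureReal_Iic l
  set N : Set ℝ := ⋃ q : ℚ, F ⁻¹' {F q} with hN
  have hNm : MeasurableSet N :=
    MeasurableSet.iUnion fun q => hmono.measurable (measurableSet_singleton _)
  have hN0 : l N = 0 := by
    refine measure_iUnion_null fun q => ?_
    rw [← Measure.map_apply hmono.measurable (measurableSet_singleton _), hmap]
    exact measure_singleton _
  have hinj' : ∀ s t, s ∉ N → F s = F t → ¬ s < t := by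
    intro s t hs h hst
    obtain ⟨q, h1, h2⟩ := exists_rat_btwn hst
    exact hs (Set.mem_iUnion.2 ⟨q, le_antisymm (hmono h1.le) (h.trans_ge (hmono h2.le))⟩)
  set A : Set Y := e ⁻¹' Nᶜ with hA
  have hAm : MeasurableSet A := he.measurable hNm.compl
  have : StandardBorelSpace A := hAm.standardBorel
  have hFA : MeasurableEmbedding fun a : A => F (e a) := by
    refine Measurable.measurableEmbedding
      (hmono.measurable.comp (he.measurable.comp measurable_subtype_coe)) fun a b hab => ?_
    have h1 := hinj' (e a) (e b) a.2 hab
    have h2 := hinj' (e b) (e a) b.2 hab.symm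
    exact Subtype.ext (he.injective (le_antisymm (not_lt.1 h2) (not_lt.1 h1)))
  obtain ⟨G, hG, hGF⟩ := hFA.exists_measurable_extend (g := fun a : A => (a : Y))
    measurable_subtype_coe fun _ => inferInstance
  refine ⟨F ∘ e, G, hmono.measurable.comp he.measurable, hG, ?_, ?_⟩
  · rw [← Measure.map_map hmono.measurable he.measurable, hmap, hl]
    congr 2
    simp [measureReal_def, Measure.map_apply he.measurable]
  · have : ∀ᵐ y ∂ν, y ∈ A := by
      rw [ae_iff]
      have : {y | y ∉ A} = e ⁻¹' N := by ext y; simp [hA]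
      rw [this, ← he.map_apply]; exact hN0
    filter_upwards [this] with y hy
    exact congrFun hGF ⟨y, hy⟩

variable {Y X : Type*} [MeasurableSpace Y] [StandardBorelSpace Y] [Nonempty Y]
  [MeasurableSpace X] [StandardBorelSpace X] [Nonempty X]

/-- Both spaces are coded by Lebesgue measure on the same interval; code one and decode into the
other. -/
theorem exists_ae_isomorphism (ν : Measure Y) [IsFiniteMeasure ν] [NullSingletonClass ν]
    (μ : Measure X) [IsFiniteMeasure μ] [NullSingletonClass μ]
    (h : ν Set.univ = μ Set.univ) :
    ∃ (J : Y → X) (J' : X → Y), MeasurePreserving J ν μ ∧ MeasurePreserving J' μ ν ∧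
      (∀ᵐ y ∂ν, J' (J y) = y) ∧ ∀ᵐ x ∂μ, J (J' x) = x := by
  obtain ⟨F₁, G₁, hF₁, hG₁, hm₁, hi₁⟩ := exists_ae_injective_map_eq_volume ν
  obtain ⟨F₂, G₂, hF₂, hG₂, hm₂, hi₂⟩ := exists_ae_injective_map_eq_volume μ
  have hmm : ν.map F₁ = μ.map F₂ := by rw [hm₁, hm₂, measureReal_def, measureReal_def, h]
  have p₁ : (ν.map F₁).map G₁ = ν := by
    rw [Measure.map_map hG₁ hF₁]
    exact (Measure.map_congr hi₁).trans Measure.map_id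
  have p₂ : (μ.map F₂).map G₂ = μ := by
    rw [Measure.map_map hG₂ hF₂]
    exact (Measure.map_congr hi₂).trans Measure.map_id
  have r₁ : ∀ᵐ u ∂(ν.map F₁), F₁ (G₁ u) = u := by
    refine (ae_map_iff hF₁.aemeasurable (measurableSet_eq_fun (hF₁.comp hG₁) measurable_id)).2 ?_
    filter_upwards [hi₁] with y hy using congrArg F₁ hy
  have r₂ : ∀ᵐ u ∂(μ.map F₂), F₂ (G₂ u) = u := by
    refine (ae_map_iff hF₂.aemeasurable (measurableSet_eq_fun (hF₂.comp hG₂) measurable_id)).2 ?_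
    filter_upwards [hi₂] with y hy using congrArg F₂ hy
  refine ⟨G₂ ∘ F₁, G₁ ∘ F₂, ⟨hG₂.comp hF₁, ?_⟩, ⟨hG₁.comp hF₂, ?_⟩, ?_, ?_⟩
  · rw [← Measure.map_map hG₂ hF₁, hmm, p₂]
  · rw [← Measure.map_map hG₁ hF₂, ← hmm, p₁]
  · rw [← hmm] at r₂
    filter_upwards [hi₁, ae_of_ae_map hF₁.aemeasurable r₂] with y h1 h2
    simp only [Function.comp_apply, h2, h1]
  · rw [hmm] at r₁
    filter_upwards [hi₂, ae_of_ae_map hF₂.aemeasurable r₁] with y h1 h2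
    simp only [Function.comp_apply, h2, h1]

variable {L : Type*} [Countable L] [MeasurableSpace L] [MeasurableSingletonClass L]

/-- Equal label laws give the fibres over each label equal mass, so isomorphisms exist fibre by
fibre and can be glued. -/
theorem exists_ae_isomorphism_of_label (ν : Measure Y) [IsFiniteMeasure ν] [NullSingletonClass ν]
    (μ : Measure X) [IsFiniteMeasure μ] [NullSingletonClass μ] {a : Y → L} {b : X → L}
    (ha : Measurable a) (hb : Measurable b) (h : ν.map a = μ.map b) :
    ∃ (J : Y → X) (J' : X → Y), MeasurePreserving J ν μ ∧ MeasurePreserving J' μ ν ∧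
      (∀ᵐ y ∂ν, J' (J y) = y) ∧ (∀ᵐ x ∂μ, J (J' x) = x) ∧ ∀ᵐ y ∂ν, b (J y) = a y := by
  have hmass : ∀ l, (ν.restrict (a ⁻¹' {l})) Set.univ = (μ.restrict (b ⁻¹' {l})) Set.univ := by
    intro l
    rw [Measure.restrict_apply_univ, Measure.restrict_apply_univ,
      ← Measure.map_apply ha (measurableSet_singleton l), h,
      Measure.map_apply hb (measurableSet_singleton l)]
  choose J J' hJ hJ' hi hi' using fun l => exists_ae_isomorphism _ _ (hmass l)
  have hL : ∀ l, ∀ᵐ y ∂(ν.restrict (a ⁻¹' {l})), b (J l y) = l := fun l =>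
    (hJ l).quasiMeasurePreserving.ae (ae_restrict_mem (hb (measurableSet_singleton l)))
  have hL' : ∀ l, ∀ᵐ x ∂(μ.restrict (b ⁻¹' {l})), a (J' l x) = l := fun l =>
    (hJ' l).quasiMeasurePreserving.ae (ae_restrict_mem (ha (measurableSet_singleton l)))
  refine ⟨fun y => J (a y) y, fun x => J' (b x) x, measurePreserving_of_fiber ha hb hJ,
    measurePreserving_of_fiber hb ha hJ', ae_of_ae_restrict_fiber ha fun l => ?_,
    ae_of_ae_restrict_fiber hb fun l => ?_, ae_of_ae_restrict_fiber ha fun l => ?_⟩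
  · filter_upwards [hi l, hL l] with y h1 h2 h3
    rw [h3, h2, h1]
  · filter_upwards [hi' l, hL' l] with y h1 h2 h3
    rw [h3, h2, h1]
  · filter_upwards [hL l] with y h2 h3
    rw [h3, h2]

end Isomorphism

/-! ### Carrying a model system to `X` -/

section Transfer

theorem Transformation.measurePreserving_symm {α : Type*} [MeasurableSpace α] {μ : Measure α}
    (T : Transformation μ) : MeasurePreserving T.toEquiv.symm μ μ :=
  T.measurePreserving.symm T.toEquiv

variable {Y X : Type*} [MeasurableSpace Y] [StandardBorelSpace Y] [Nonempty Y]
  [MeasurableSpace X] [StandardBorelSpace X] [Nonempty X]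

/-- A transformation of `Y` with a measure-preserving observable `π : Y → X` is realized on `X`, so
far as the correlations of finitely many sets are concerned. -/
theorem exists_transformation_correlations_eq {ν : Measure Y} [IsFiniteMeasure ν]
    [NullSingletonClass ν] {μ : Measure X} [IsFiniteMeasure μ] [NullSingletonClass μ]
    (S : Transformation ν) {π : Y → X} (hπ : MeasurePreserving π ν μ) {κ : Type*} [Finite κ]
    {H : κ → Set X} (hH : ∀ k, MeasurableSet (H k)) :
    ∃ Q : Transformation μ, ∀ k k' i, μ.real (Q.toEquiv^[i] ⁻¹' H k ∩ H k') =
      ν.real (S.toEquiv^[i] ⁻¹' (π ⁻¹' H k) ∩ π ⁻¹' H k') := by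
  classical
  -- The label records membership in every `H k`. The isomorphism `J` need not equal `π`, but it
  -- gives `J y` the label of `π y`, and the correlations see nothing else.
  let b : X → κ → Bool := fun x k => decide (x ∈ H k)
  have hb : Measurable b := measurable_pi_lambda _ fun k =>
    measurable_to_bool (by simpa [Set.preimage, b] using hH k)
  obtain ⟨J, J', hJ, hJ', hi, hi', hl⟩ := exists_ae_isomorphism_of_label ν μ
    (hb.comp hπ.measurable) hb (by rw [← Measure.map_map hb hπ.measurable, hπ.map_eq])
  have hS := S.measurePreserving
  have hS' := S.measurePreserving_symm
  obtain ⟨Q, hQ, -⟩ := exists_transformation_of_ae_inverse (f := J ∘ S.toEquiv ∘ J')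
    (g := J ∘ S.toEquiv.symm ∘ J') (hJ.comp (hS.comp hJ')) (hJ.comp (hS'.comp hJ'))
    (by
      filter_upwards [(hS.comp hJ').quasiMeasurePreserving.ae hi, hi'] with x h1 h2
      simp only [Function.comp_apply] at h1 ⊢
      rw [h1, MeasurableEquiv.symm_apply_apply, h2])
    (by
      filter_upwards [(hS'.comp hJ').quasiMeasurePreserving.ae hi, hi'] with x h1 h2
      simp only [Function.comp_apply] at h1 ⊢
      rw [h1, MeasurableEquiv.apply_symm_apply, h2])
  have hQJ : ∀ᵐ y ∂ν, Q.toEquiv (J y) = J (S.toEquiv y) := by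
    filter_upwards [hJ.quasiMeasurePreserving.ae hQ, hi] with y h1 h2
    rw [h1]; simp only [Function.comp_apply, h2]
  have hQJi : ∀ i : ℕ, ∀ᵐ y ∂ν, Q.toEquiv^[i] (J y) = J (S.toEquiv^[i] y) := by
    intro i
    induction i with
    | zero => simp
    | succ i ih =>
      filter_upwards [ih, (hS.iterate i).quasiMeasurePreserving.ae hQJ] with y h1 h2
      rw [Function.iterate_succ_apply', Function.iterate_succ_apply', h1, h2]
  refine ⟨Q, fun k k' i => ?_⟩
  have hm : MeasurableSet (Q.toEquiv^[i] ⁻¹' H k ∩ H k') :=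
    ((Q.toEquiv.measurable.iterate i) (hH k)).inter (hH k')
  rw [← hJ.measureReal_preimage hm.nullMeasurableSet]
  apply measureReal_congr
  have hl' : ∀ᵐ y ∂ν, ∀ k, J y ∈ H k ↔ π y ∈ H k := by
    filter_upwards [hl] with y hy k
    simpa [b] using congrFun hy k
  filter_upwards [hQJi i, hl', (hS.iterate i).quasiMeasurePreserving.ae hl'] with y h1 h2 h3
  refine propext ?_
  change (Q.toEquiv^[i] (J y) ∈ H k ∧ J y ∈ H k') ↔ (π (S.toEquiv^[i] y) ∈ H k ∧ π y ∈ H k')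
  rw [h1, h3, h2]

end Transfer
-- Transformations read off from finite itineraries
section Itinerary

variable {X : Type*} [MeasurableSpace X]

theorem pi_real_same_coordinate (μ : Measure X) [IsProbabilityMeasure μ] {Z : Type*} [Fintype Z]
    (R : Transformation μ) {E F : Set X} (hE : MeasurableSet E) (hF : MeasurableSet F) (a : Z)
    (e i : ℕ) :
    (Measure.pi fun _ : Z => μ).real
      {x | R.toEquiv^[e + i] (x a) ∈ E ∧ R.toEquiv^[e] (x a) ∈ F} =
        μ.real (R.toEquiv^[i] ⁻¹' E ∩ F) := by
  have h : MeasurePreserving (fun x : Z → X => R.toEquiv^[e] (x a)) (Measure.pi fun _ : Z => μ) μ :=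
    (R.measurePreserving.iterate e).comp (measurePreserving_eval (fun _ : Z => μ) a)
  rw [← h.measureReal_preimage
    (((R.toEquiv.measurable.iterate i) hE).inter hF).nullMeasurableSet]
  congr 1
  ext x
  simp only [Set.mem_ofPred_eq, Set.mem_preimage, Set.mem_inter_iff, ← Function.iterate_add_apply,
    Nat.add_comm e i]

theorem pi_real_distinct_coordinates (μ : Measure X) [IsProbabilityMeasure μ] {Z : Type*}
    [Fintype Z] (R : Transformation μ) {E F : Set X} (hE : MeasurableSet E) (hF : MeasurableSet F)
    {a b : Z} (hab : a ≠ b) (e e' : ℕ) :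
    (Measure.pi fun _ : Z => μ).real
      {x | R.toEquiv^[e] (x a) ∈ E ∧ R.toEquiv^[e'] (x b) ∈ F} = μ.real E * μ.real F := by
  have hind := (ProbabilityTheory.iIndepFun_pi (μ := fun _ : Z => μ) (X := fun _ => id)
    fun _ => aemeasurable_id).indepFun hab
  have h := hind.measure_inter_preimage_eq_mul _ _ ((R.toEquiv.measurable.iterate e) hE)
    ((R.toEquiv.measurable.iterate e') hF)
  have h1 : ∀ (c : Z) (d : ℕ) {G : Set X}, MeasurableSet G →
      (Measure.pi fun _ : Z => μ) ((fun x : Z → X => id (x c)) ⁻¹' (R.toEquiv^[d] ⁻¹' G)) = μ G :=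
    fun c d G hG => ((R.measurePreserving.iterate d).comp
      (measurePreserving_eval (fun _ : Z => μ) c)).measure_preimage hG.nullMeasurableSet
  rw [h1 a e hE, h1 b e' hF] at h
  rw [measureReal_def, measureReal_def, measureReal_def, ← ENNReal.toReal_mul, ← h]
  rfl

variable [StandardBorelSpace X]

/-- The model lives on `(Z → X) × Z`: the random points `x` stay frozen and only `z` moves, by `s`.
The map `R` enters through the observable alone, which for each fixed `z` reads one coordinate
shifted by a power of `R` and so has law `μ`. -/
theorem exists_transformation_of_itinerary {μ : Measure X} [IsProbabilityMeasure μ]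
    [NullSingletonClass μ] (R : Transformation μ) {Z : Type*} [Fintype Z] [Nonempty Z]
    (s : Equiv.Perm Z) {w : Z → ℝ} (hw : ∀ z, 0 ≤ w z) (hw1 : ∑ z, w z = 1)
    (hs : ∀ z, w (s z) = w z) (blk : Z → Z) (ex : Z → ℕ) {κ : Type*} [Finite κ]
    {H : κ → Set X} (hH : ∀ k, MeasurableSet (H k)) :
    ∃ Q : Transformation μ, ∀ k k' i, μ.real (Q.toEquiv^[i] ⁻¹' H k ∩ H k') =
      ∑ z, w z * (Measure.pi fun _ : Z => μ).real
        {x | R.toEquiv^[ex (s^[i] z)] (x (blk (s^[i] z))) ∈ H k ∧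
          R.toEquiv^[ex z] (x (blk z)) ∈ H k'} := by
  classical
  let _ : MeasurableSpace Z := ⊤
  have : DiscreteMeasurableSpace Z := ⟨fun _ => trivial⟩
  have : Nonempty X := μ.nonempty_of_neZero
  let η : Measure (Z → X) := Measure.pi fun _ : Z => μ
  let ζ : Measure Z := ∑ z, ENNReal.ofReal (w z) • Measure.dirac z
  have hζ : ∀ f : Z → ℝ≥0∞, ∫⁻ z, f z ∂ζ = ∑ z, ENNReal.ofReal (w z) * f z := fun f => by
    simp only [ζ, lintegral_finsetSum_measure, lintegral_smul_measure, lintegral_dirac, smul_eq_mul]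
  have hζ1 : IsProbabilityMeasure ζ := ⟨by
    rw [← lintegral_one, hζ]
    simp only [mul_one]
    rw [← ENNReal.ofReal_sum_of_nonneg fun z _ => hw z, hw1, ENNReal.ofReal_one]⟩
  have hsζ : MeasurePreserving s ζ ζ := by
    refine ⟨measurable_of_countable _, Measure.ext_of_lintegral _ fun f hf => ?_⟩
    rw [lintegral_map hf (measurable_of_countable _), hζ, hζ]
    rw [← Equiv.sum_comp s fun z => ENNReal.ofReal (w z) * f z]
    exact Finset.sum_congr rfl fun z _ => by rw [hs]
  have hreal : ∀ A : Set ((Z → X) × Z), MeasurableSet A →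
      (η.prod ζ).real A = ∑ z, w z * η.real {x | (x, z) ∈ A} := by
    intro A hA
    rw [measureReal_def, Measure.prod_apply_symm hA, hζ, ENNReal.toReal_sum]
    · refine Finset.sum_congr rfl fun z _ => ?_
      rw [ENNReal.toReal_mul, ENNReal.toReal_ofReal (hw z)]
      rfl
    · exact fun z _ => ENNReal.mul_ne_top ENNReal.ofReal_ne_top (measure_ne_top _ _)
  let S : Transformation (η.prod ζ) :=
    ⟨(MeasurableEquiv.refl _).prodCongr
      ⟨s, measurable_of_countable _, measurable_of_countable _⟩,
      (MeasurePreserving.id η).prod hsζ⟩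
  have hSi : ∀ (i : ℕ) (y : (Z → X) × Z), S.toEquiv^[i] y = (y.1, s^[i] y.2) := by
    intro i
    induction i with
    | zero => intro y; rfl
    | succ i ih => intro y; rw [Function.iterate_succ_apply, ih]; rfl
  let π : (Z → X) × Z → X := fun y => R.toEquiv^[ex y.2] (y.1 (blk y.2))
  have hπm : Measurable π := measurable_from_prod_countable_left fun z =>
    (R.toEquiv.measurable.iterate (ex z)).comp (measurable_pi_apply (blk z))
  have hπ : MeasurePreserving π (η.prod ζ) μ := by
    refine ⟨hπm, ?_⟩
    ext E hE
    rw [Measure.map_apply hπm hE, Measure.prod_apply_symm (hπm hE)]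
    have : ∀ z, η ((fun x => (x, z)) ⁻¹' (π ⁻¹' E)) = μ E := fun z =>
      ((R.measurePreserving.iterate (ex z)).comp
        (measurePreserving_eval (fun _ : Z => μ) (blk z))).measure_preimage hE.nullMeasurableSet
    simp only [this, lintegral_const, measure_univ, mul_one]
  obtain ⟨Q, hQ⟩ := exists_transformation_correlations_eq S hπ hH
  refine ⟨Q, fun k k' i => ?_⟩
  rw [hQ, hreal _ (((S.toEquiv.measurable.iterate i) (hπm (hH k))).inter (hπm (hH k')))]
  refine Finset.sum_congr rfl fun z _ => ?_
  congr 3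
  ext x
  simp only [Set.mem_inter_iff, Set.mem_preimage, hSi, π]

end Itinerary

/-! ### Cycles cut into independent blocks -/

section Tower

/-- The permutation `t ↦ t + 1` of each of the cycles `ℤ / q j`. -/
def cycleShift {ι : Type*} (q : ι → ℕ) [∀ j, NeZero (q j)] : Equiv.Perm (Σ j, Fin (q j)) :=
  Equiv.sigmaCongrRight fun j => Equiv.addRight (1 : Fin (q j))

theorem cycleShift_iterate {ι : Type*} (q : ι → ℕ) [∀ j, NeZero (q j)] (i : ℕ) (j : ι)
    (t : Fin (q j)) :
    (cycleShift q)^[i] ⟨j, t⟩ = ⟨j, ⟨(t + i) % q j, Nat.mod_lt _ (NeZero.pos _)⟩⟩ := by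
  induction i with
  | zero => simp [Nat.mod_eq_of_lt t.2]
  | succ i ih =>
    rw [Function.iterate_succ_apply', ih]
    change (⟨j, _⟩ : Σ j, Fin (q j)) = _
    congr 1
    ext
    simp only [Equiv.coe_addRight, Fin.val_add, Fin.coe_ofNat_eq_mod, Nat.mod_add_mod,
      Nat.add_mod_mod]
    rw [add_assoc]

theorem sum_cycleShift_iterate {ι : Type*} (q : ι → ℕ) [∀ j, NeZero (q j)]
    (f : (Σ j, Fin (q j)) → ℝ) (j : ι) (i : ℕ) :
    ∑ t : Fin (q j), f ((cycleShift q)^[i] ⟨j, t⟩) = ∑ t : Fin (q j), f ⟨j, t⟩ := by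
  induction i with
  | zero => rfl
  | succ i ih =>
    rw [← ih]
    exact Equiv.sum_comp (Equiv.addRight (1 : Fin (q j))) fun t => f ((cycleShift q)^[i] ⟨j, t⟩)

/-- The times at which an itinerary made of blocks of length `M` is broken. -/
def blockBreak {ι : Type*} (q : ι → ℕ) (M : ℕ) (z : Σ j, Fin (q j)) : Prop :=
  z.2 + 1 = q z.1 ∨ M ∣ z.2 + 1

-- The end of the cycle contributes the `1`, the multiples of `M` the quotient.
open Classical in
theorem sum_blockBreak_le {ι : Type*} (q : ι → ℕ) (M : ℕ) (j : ι) :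
    ∑ t : Fin (q j), (if blockBreak q M ⟨j, t⟩ then (1 : ℝ) else 0) ≤ 1 + q j / M := by
  have h1 : ∀ t : Fin (q j), (if blockBreak q M ⟨j, t⟩ then (1 : ℝ) else 0) ≤
      (if (t : ℕ) + 1 = q j then (1 : ℝ) else 0) + if M ∣ (t : ℕ) + 1 then 1 else 0 := by
    intro t
    unfold blockBreak
    simp only
    split_ifs <;> simp_all
  refine (Finset.sum_le_sum fun t _ => h1 t).trans ?_
  rw [Finset.sum_add_distrib,
    Fin.sum_univ_eq_sum_range (fun t => if t + 1 = q j then (1 : ℝ) else 0),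
    Fin.sum_univ_eq_sum_range (fun t => if M ∣ t + 1 then (1 : ℝ) else 0), Finset.sum_boole,
    Finset.sum_boole, Nat.card_multiples]
  refine add_le_add ?_ Nat.cast_div_le
  have : {t ∈ Finset.range (q j) | t + 1 = q j} ⊆ {q j - 1} := by
    intro t ht
    simp only [Finset.mem_filter, Finset.mem_range, Finset.mem_singleton] at ht ⊢
    omega
  exact_mod_cast Finset.card_le_card this

/-- The beginning of the block of a point in a cycle. -/
def blockIndex {ι : Type*} (q : ι → ℕ) (M : ℕ) (z : Σ j, Fin (q j)) : Σ j, Fin (q j) :=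
  ⟨z.1, ⟨z.2 / M, (Nat.div_le_self _ _).trans_lt z.2.2⟩⟩

/-- Without a break the cycle does not wrap and no multiple of `M` is crossed: the quotient by `M`
stays put and the remainder counts steps. Such a stretch therefore displays successive points of a
single `R`-orbit. -/
theorem blockIndex_iterate_of_not_blockBreak {ι : Type*} (q : ι → ℕ) [∀ j, NeZero (q j)] {M : ℕ}
    (z : Σ j, Fin (q j)) (i : ℕ)
    (h : ∀ l < i, ¬ blockBreak q M ((cycleShift q)^[l] z)) :
    blockIndex q M ((cycleShift q)^[i] z) = blockIndex q M z ∧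
      (((cycleShift q)^[i] z).2 : ℕ) % M = z.2 % M + i := by
  induction i with
  | zero => simp
  | succ i ih =>
    obtain ⟨h1, h2⟩ := ih fun l hl => h l (hl.trans i.lt_succ_self)
    have h3 := h i i.lt_succ_self
    rw [Function.iterate_succ_apply']
    set y := (cycleShift q)^[i] z
    obtain ⟨j, t⟩ := y
    have h4 := cycleShift_iterate q 1 j t
    rw [Function.iterate_one] at h4
    simp only [blockBreak, not_or] at h3
    have hlt : (t : ℕ) + 1 < q j := lt_of_le_of_ne t.2 h3.1
    rw [h4]
    have hdiv : ((t : ℕ) + 1) / M = t / M := by rw [Nat.succ_div, if_neg h3.2, add_zero]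
    have hmod : ((t : ℕ) + 1) % M = t % M + 1 := by
      have := Nat.div_add_mod (t + 1) M
      have := Nat.div_add_mod t M
      rw [hdiv] at *
      omega
    refine ⟨?_, ?_⟩
    · rw [← h1]
      simp only [blockIndex, Nat.mod_eq_of_lt hlt, hdiv]
    · simp only [Nat.mod_eq_of_lt hlt, hmod]
      simp only at h2
      omega

-- Few steps rarely meet a break, so low-order correlations of `Q` are those of `R`, up to the break
-- frequency per step times the number of steps. At time `n` the cycle indexed by `some i` has
-- turned once and `i` steps more, while on the cycle indexed by `none` one stands half a turn away,
-- in a block with an independent coordinate. Averaging with weights `p` gives the mixture.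
open Classical in
theorem exists_transformation_tower {X : Type*} [MeasurableSpace X] [StandardBorelSpace X]
    {μ : Measure X} [IsProbabilityMeasure μ] [NullSingletonClass μ] (R : Transformation μ)
    {κ : Type*} [Finite κ] {H : κ → Set X} (hH : ∀ k, MeasurableSet (H k)) {K M n : ℕ}
    (hM : 0 < M) (hMn : M ≤ n) (hKn : K < n) {p : Option (Fin K) → ℝ} (hp : ∀ j, 0 ≤ p j)
    (hp1 : ∑ j, p j = 1) :
    ∃ Q : Transformation μ,
      (∀ k k' i, |μ.real (Q.toEquiv^[i] ⁻¹' H k ∩ H k') - μ.real (R.toEquiv^[i] ⁻¹' H k ∩ H k')| ≤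
        i * (1 / (n - K : ℝ) + 1 / M)) ∧
      ∀ k k', |μ.real (Q.toEquiv^[n] ⁻¹' H k ∩ H k') - (p none * (μ.real (H k) * μ.real (H k')) +
        ∑ i : Fin K, p (some i) * μ.real (R.toEquiv^[(i : ℕ)] ⁻¹' H k ∩ H k'))| ≤
          K * (1 / (n - K : ℝ) + 1 / M) := by
  -- Length `n - i` makes `n` steps equal to `i` steps; length `2 * n` makes `n` steps half a turn.
  -- All lengths are at least `n - K`, which bounds the frequency of cycle ends.
  let q : Option (Fin K) → ℕ := fun j => j.elim (2 * n) fun i => n - i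
  have hqn : ∀ j, n - K ≤ q j := by
    rintro (_ | i) <;> simp only [q, Option.elim] <;> omega
  have hq0 : ∀ j, NeZero (q j) := fun j => ⟨by have := hqn j; omega⟩
  have hnK : (0 : ℝ) < n - K := sub_pos.2 (by exact_mod_cast hKn)
  have hqR : ∀ j, (n - K : ℝ) ≤ q j := fun j => by
    have := hqn j
    rw [← Nat.cast_sub hKn.le]
    exact_mod_cast this
  set δ : ℝ := 1 / (n - K : ℝ) + 1 / M with hδ
  have hδ0 : 0 ≤ δ := by positivity
  let w : (Σ j, Fin (q j)) → ℝ := fun z => p z.1 / q z.1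
  let c' : κ → κ → (Σ j, Fin (q j)) → (Σ j, Fin (q j)) → ℝ := fun k k' y z =>
    (Measure.pi fun _ : (Σ j, Fin (q j)) => μ).real
      {x | R.toEquiv^[(y.2 : ℕ) % M] (x (blockIndex q M y)) ∈ H k ∧
        R.toEquiv^[(z.2 : ℕ) % M] (x (blockIndex q M z)) ∈ H k'}
  let c : κ → κ → ℕ → (Σ j, Fin (q j)) → ℝ := fun k k' i z => c' k k' ((cycleShift q)^[i] z) z
  have hqpos : ∀ j, (0 : ℝ) < q j := fun j => hnK.trans_le (hqR j)
  have hne : Nonempty (Σ j, Fin (q j)) := ⟨⟨none, 0⟩⟩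
  obtain ⟨Q, hQ⟩ := exists_transformation_of_itinerary R (cycleShift q) (w := w)
    (fun z => div_nonneg (hp _) (hqpos _).le)
    (by
      rw [Fintype.sum_sigma, ← hp1]
      refine Finset.sum_congr rfl fun j _ => ?_
      simp only [w, Finset.sum_const, Finset.card_univ, Fintype.card_fin, nsmul_eq_mul]
      exact mul_div_cancel₀ _ (hqpos j).ne')
    (fun z => rfl) (blockIndex q M) (fun z => (z.2 : ℕ) % M) hH
  have hsum : ∀ k k' i, μ.real (Q.toEquiv^[i] ⁻¹' H k ∩ H k') =
      ∑ j, p j * ((∑ t : Fin (q j), c k k' i ⟨j, t⟩) / q j) := by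
    intro k k' i
    rw [hQ, Fintype.sum_sigma]
    refine Finset.sum_congr rfl fun j _ => ?_
    rw [mul_div_assoc', Finset.mul_sum, Finset.sum_div]
    exact Finset.sum_congr rfl fun t _ => by simp only [w, c, c']; ring
  have havg : ∀ k k' i j, |(∑ t : Fin (q j), c k k' i ⟨j, t⟩) / q j -
      μ.real (R.toEquiv^[i] ⁻¹' H k ∩ H k')| ≤ i * δ := by
    intro k k' i j
    set r := μ.real (R.toEquiv^[i] ⁻¹' H k ∩ H k') with hr
    have h1 : ∀ z, |c k k' i z - r| ≤
        ∑ l ∈ Finset.range i, if blockBreak q M ((cycleShift q)^[l] z) then (1 : ℝ) else 0 := by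
      intro z
      -- Either no break occurs and the two values agree, or the right side is at least `1` while
      -- both values lie in `[0, 1]`.
      by_cases hz : ∀ l < i, ¬ blockBreak q M ((cycleShift q)^[l] z)
      · obtain ⟨e1, e2⟩ := blockIndex_iterate_of_not_blockBreak q z i hz
        have : c k k' i z = r := by
          simp only [c, c', e1, e2]
          exact pi_real_same_coordinate μ R (hH k) (hH k') _ _ _
        rw [this, sub_self, abs_zero]
        exact Finset.sum_nonneg fun l _ => by split_ifs <;> norm_num
      · push Not at hz
        obtain ⟨l, hl, hbl⟩ := hz
        have h2 : (1 : ℝ) ≤ ∑ l ∈ Finset.range i,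
            if blockBreak q M ((cycleShift q)^[l] z) then (1 : ℝ) else 0 := by
          have := Finset.single_le_sum (f := fun l =>
            if blockBreak q M ((cycleShift q)^[l] z) then (1 : ℝ) else 0)
            (fun l _ => by split_ifs <;> norm_num) (Finset.mem_range.2 hl)
          simpa [hbl] using this
        refine le_trans ?_ h2
        have h3 : 0 ≤ c k k' i z := measureReal_nonneg
        have h4 : c k k' i z ≤ 1 := measureReal_le_one
        have h5 : 0 ≤ r := measureReal_nonneg
        have h6 : r ≤ 1 := measureReal_le_one
        rw [abs_le]; constructor <;> linarith
    have h7 : (∑ t : Fin (q j), c k k' i ⟨j, t⟩) / q j - r =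
        (∑ t : Fin (q j), (c k k' i ⟨j, t⟩ - r)) / q j := by
      rw [Finset.sum_sub_distrib, Finset.sum_const, Finset.card_univ, Fintype.card_fin,
        nsmul_eq_mul, sub_div, mul_div_cancel_left₀ _ (hqpos j).ne']
    rw [h7, abs_div, abs_of_pos (hqpos j), div_le_iff₀ (hqpos j)]
    calc |∑ t : Fin (q j), (c k k' i ⟨j, t⟩ - r)|
        ≤ ∑ t : Fin (q j), |c k k' i ⟨j, t⟩ - r| := Finset.abs_sum_le_sum_abs _ _
      _ ≤ ∑ t : Fin (q j), ∑ l ∈ Finset.range i,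
            if blockBreak q M ((cycleShift q)^[l] ⟨j, t⟩) then (1 : ℝ) else 0 :=
          Finset.sum_le_sum fun t _ => h1 _
      _ = ∑ l ∈ Finset.range i, ∑ t : Fin (q j),
            if blockBreak q M ((cycleShift q)^[l] ⟨j, t⟩) then (1 : ℝ) else 0 := Finset.sum_comm
      _ ≤ ∑ l ∈ Finset.range i, (1 + q j / M : ℝ) := by
          refine Finset.sum_le_sum fun l _ => ?_
          rw [sum_cycleShift_iterate q (fun z => if blockBreak q M z then (1 : ℝ) else 0)]
          exact sum_blockBreak_le q M j
      _ = i * (1 + q j / M) := by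
          rw [Finset.sum_const, Finset.card_range, nsmul_eq_mul]
      _ ≤ i * δ * q j := by
          rw [mul_assoc]
          refine mul_le_mul_of_nonneg_left ?_ (Nat.cast_nonneg i)
          rw [hδ, add_mul]
          refine add_le_add ?_ (by rw [one_div_mul_eq_div])
          rw [one_div_mul_eq_div, le_div_iff₀ hnK, one_mul]
          exact hqR j
  have hcomb : ∀ (a b : Option (Fin K) → ℝ) (C : ℝ), (∀ j, |a j - b j| ≤ C) →
      |∑ j, p j * a j - ∑ j, p j * b j| ≤ C := by
    intro a b C h
    rw [← Finset.sum_sub_distrib]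
    calc |∑ j, (p j * a j - p j * b j)| ≤ ∑ j, |p j * a j - p j * b j| :=
          Finset.abs_sum_le_sum_abs _ _
      _ ≤ ∑ j, p j * C := Finset.sum_le_sum fun j _ => by
          rw [← mul_sub, abs_mul, abs_of_nonneg (hp j)]
          exact mul_le_mul_of_nonneg_left (h j) (hp j)
      _ = C := by rw [← Finset.sum_mul, hp1, one_mul]
  refine ⟨Q, fun k k' i => ?_, fun k k' => ?_⟩
  · have h := hcomb _ (fun _ => μ.real (R.toEquiv^[i] ⁻¹' H k ∩ H k')) _ (havg k k' i)
    rwa [← Finset.sum_mul, hp1, one_mul, ← hsum] at h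
  · have h := hcomb (fun j => (∑ t : Fin (q j), c k k' n ⟨j, t⟩) / q j)
      (fun j => j.elim (μ.real (H k) * μ.real (H k')) fun i =>
        μ.real (R.toEquiv^[(i : ℕ)] ⁻¹' H k ∩ H k')) (K * δ) ?_
    · rwa [← hsum, Fintype.sum_option] at h
    · rintro (_ | i)
      · have h1 : ∀ t : Fin (q none), c k k' n ⟨none, t⟩ = μ.real (H k) * μ.real (H k') := by
          intro t
          refine pi_real_distinct_coordinates μ R (hH k) (hH k') (fun h => ?_) _ _
          rw [cycleShift_iterate] at h
          simp only [blockIndex, Sigma.mk.injEq, heq_eq_eq, Fin.mk.injEq, true_and] at h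
          have ht : (t : ℕ) < 2 * n := t.2
          change (((t : ℕ) + n) % (2 * n)) / M = t / M at h
          -- Since `M ≤ n`, the block index rises by at least one without wrapping and drops by at
          -- least one with it.
          rcases lt_or_ge ((t : ℕ) + n) (2 * n) with h2 | h2
          · rw [Nat.mod_eq_of_lt h2] at h
            have : (t + M) / M ≤ ((t : ℕ) + n) / M := Nat.div_le_div_right (by omega)
            rw [Nat.add_div_right _ hM] at this
            omega
          · rw [Nat.mod_eq_sub_mod h2, Nat.mod_eq_of_lt (by omega)] at h
            have : ((t + n - 2 * n) + M) / M ≤ (t : ℕ) / M := Nat.div_le_div_right (by omega)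
            rw [Nat.add_div_right _ hM] at this
            omega
        simp only [h1, Option.elim, Finset.sum_const, Finset.card_univ, Fintype.card_fin,
          nsmul_eq_mul]
        rw [mul_div_cancel_left₀ _ (hqpos none).ne', sub_self, abs_zero]
        positivity
      · have h1 : ∀ t : Fin (q (some i)), c k k' n ⟨some i, t⟩ = c k k' i ⟨some i, t⟩ := by
          intro t
          have : (cycleShift q)^[n] ⟨some i, t⟩ = (cycleShift q)^[(i : ℕ)] ⟨some i, t⟩ := by
            have hi := i.2
            have h2 : (t : ℕ) + n = t + i + (n - i) := by omega
            rw [cycleShift_iterate, cycleShift_iterate]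
            congr 2
            change ((t : ℕ) + n) % (n - i) = (t + i) % (n - i)
            rw [h2, Nat.add_mod_right]
          simp only [c, this]
        simp only [h1, Option.elim]
        refine (havg k k' i (some i)).trans ?_
        exact mul_le_mul_of_nonneg_right (by exact_mod_cast i.2.le) hδ0

end Tower
-- Matrix coefficients of admissible functions at indicators
section Correlation

variable {X : Type*} [MeasurableSpace X]

/-- The matrix coefficient of `P(T)` at the indicator functions of `E` and `F`. -/
noncomputable def AdmissibleFunction.correlation (P : AdmissibleFunction) (μ : Measure X)
    (T : X → X) (E F : Set X) : ℝ :=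
  P.c * (μ.real E * μ.real F) + ∑' i, P.coeff i * μ.real (T^[i] ⁻¹' E ∩ F)

variable (P : AdmissibleFunction) (μ : Measure X) [IsProbabilityMeasure μ] (T : X → X)
  (E F : Set X)

theorem AdmissibleFunction.coeff_mul_le (i : ℕ) :
    P.coeff i * μ.real (T^[i] ⁻¹' E ∩ F) ≤ P.coeff i :=
  mul_le_of_le_one_right (P.coeff_nonneg i) measureReal_le_one

theorem AdmissibleFunction.summable_correlation :
    Summable fun i => P.coeff i * μ.real (T^[i] ⁻¹' E ∩ F) :=
  Summable.of_nonneg_of_le (fun i => mul_nonneg (P.coeff_nonneg i) measureReal_nonneg)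
    (P.coeff_mul_le μ T E F) P.hasSum_coeff.summable

theorem AdmissibleFunction.sum_coeff_le (K : ℕ) : ∑ i ∈ Finset.range K, P.coeff i ≤ 1 - P.c :=
  sum_le_hasSum _ (fun i _ => P.coeff_nonneg i) P.hasSum_coeff

/-- Correlations lie in `[0, 1]`, so the omitted terms add up to at most the omitted coefficient
mass, whatever `T` is. -/
theorem AdmissibleFunction.abs_correlation_sub_le (K : ℕ) :
    |P.correlation μ T E F - (P.c * (μ.real E * μ.real F) +
      ∑ i ∈ Finset.range K, P.coeff i * μ.real (T^[i] ⁻¹' E ∩ F))| ≤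
        1 - P.c - ∑ i ∈ Finset.range K, P.coeff i := by
  have h1 := (P.summable_correlation μ T E F).sum_add_tsum_nat_add K
  have h2 := P.hasSum_coeff.summable.sum_add_tsum_nat_add K
  rw [P.hasSum_coeff.tsum_eq] at h2
  have h3 : 0 ≤ ∑' i, P.coeff (i + K) * μ.real (T^[i + K] ⁻¹' E ∩ F) :=
    tsum_nonneg fun i => mul_nonneg (P.coeff_nonneg _) measureReal_nonneg
  have h4 : ∑' i, P.coeff (i + K) * μ.real (T^[i + K] ⁻¹' E ∩ F) ≤ ∑' i, P.coeff (i + K) :=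
    ((summable_nat_add_iff K).2 (P.summable_correlation μ T E F)).tsum_le_tsum
      (fun i => P.coeff_mul_le μ T E F _) ((summable_nat_add_iff K).2 P.hasSum_coeff.summable)
  unfold AdmissibleFunction.correlation
  rw [← h1, abs_le]
  constructor <;> linarith

omit [IsProbabilityMeasure μ] in
theorem AdmissibleFunction.correlation_nonneg : 0 ≤ P.correlation μ T E F :=
  add_nonneg (mul_nonneg P.c_nonneg (by positivity))
    (tsum_nonneg fun i => mul_nonneg (P.coeff_nonneg _) measureReal_nonneg)

theorem AdmissibleFunction.correlation_le_one : P.correlation μ T E F ≤ 1 := by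
  have h1 : P.c * (μ.real E * μ.real F) ≤ P.c :=
    mul_le_of_le_one_right P.c_nonneg
      (mul_le_one₀ measureReal_le_one measureReal_nonneg measureReal_le_one)
  have h2 := (P.summable_correlation μ T E F).tsum_le_tsum (P.coeff_mul_le μ T E F)
    P.hasSum_coeff.summable
  rw [P.hasSum_coeff.tsum_eq] at h2
  unfold AdmissibleFunction.correlation
  linarith

end Correlation

/-! ### Perturbing one transformation -/

section Approximation

variable {X : Type*} [MeasurableSpace X]

/-- Turns closeness of sets into a statement about correlations, which is what the tower controls.
-/
theorem measureReal_symmDiff_eq (μ : Measure X) [IsFiniteMeasure μ] {A B : Set X}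
    (hA : MeasurableSet A) (hB : MeasurableSet B) :
    μ.real (A ∆ B) = μ.real A + μ.real B - 2 * μ.real (A ∩ B) := by
  have h1 := measureReal_inter_add_sdiff (μ := μ) (s := A) hB
  have h2 := measureReal_inter_add_sdiff (μ := μ) (s := B) hA
  rw [Set.symmDiff_def, measureReal_union (disjoint_sdiff_sdiff) (hB.diff hA)]
  rw [Set.inter_comm] at h2
  linarith

variable [StandardBorelSpace X]

/-- Apply the tower with the coefficients of `P` truncated at `K`. It approximates `P(R)`, but
correlations of order below `K` hardly change from `R` to `Q`, so `P(Q)` may be put in its place. -/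
theorem exists_transformation_near_correlation {μ : Measure X} [IsProbabilityMeasure μ]
    [NullSingletonClass μ] (R : Transformation μ) (P : AdmissibleFunction) {κ : Type*} [Finite κ]
    {H : κ → Set X} (hH : ∀ k, MeasurableSet (H k)) {ε : ℝ} (hε : 0 < ε) :
    ∃ n₀ : ℕ, ∀ n ≥ n₀, ∃ Q : Transformation μ,
      (∀ k, μ.real ((Q.toEquiv '' H k) ∆ (R.toEquiv '' H k)) < ε ∧
        μ.real ((Q.toEquiv ⁻¹' H k) ∆ (R.toEquiv ⁻¹' H k)) < ε) ∧
      ∀ k k', |μ.real (Q.toEquiv^[n] ⁻¹' H k ∩ H k') -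
        P.correlation μ Q.toEquiv (H k) (H k')| < ε := by
  obtain ⟨K, hK, hK0⟩ : ∃ K : ℕ, 1 - P.c - ∑ i ∈ Finset.range K, P.coeff i < ε / 8 ∧ 0 < K := by
    have h := (P.hasSum_coeff.tendsto_sum_nat.const_sub (1 - P.c)).eventually_lt_const
      (u := ε / 8) (by rw [sub_self]; positivity)
    exact (h.and (eventually_gt_atTop 0)).exists
  set r := 1 - P.c - ∑ i ∈ Finset.range K, P.coeff i with hr
  have hr0 : 0 ≤ r := sub_nonneg.2 (P.sum_coeff_le K)
  -- With block length `m` and `n ≥ K + m`, both parts of `δ` are at most `1 / m`, so `(K + 1) * δ <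
  -- ε / 8`.
  obtain ⟨m, hm⟩ := exists_nat_gt (16 * (K + 1) / ε)
  have hmR : (0 : ℝ) < m := lt_of_le_of_lt (by positivity) hm
  have hm0 : 0 < m := by exact_mod_cast hmR
  refine ⟨K + m, fun n hn => ?_⟩
  -- The truncated mass `r` is placed at `i = 0` to keep a probability vector; this needs `K > 0`.
  let p : Option (Fin K) → ℝ := fun j => j.elim P.c fun i =>
    P.coeff i + if (i : ℕ) = 0 then r else 0
  have hite : ∀ f : ℕ → ℝ, ∑ i : Fin K, (P.coeff i + if (i : ℕ) = 0 then r else 0) * f i =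
      ∑ i ∈ Finset.range K, P.coeff i * f i + r * f 0 := by
    intro f
    rw [Fin.sum_univ_eq_sum_range (fun i => (P.coeff i + if i = 0 then r else 0) * f i)]
    simp only [add_mul, Finset.sum_add_distrib, ite_mul, zero_mul, Finset.sum_ite_eq',
      Finset.mem_range, hK0, if_true]
  -- Adding the `R`-images and `R`-preimages of the `H k` makes closeness of `Q` to `R` on `H k` a
  -- first-order correlation.
  obtain ⟨Q, hQ1, hQ2⟩ := exists_transformation_tower R
    (H := Sum.elim H (Sum.elim (fun k => R.toEquiv ⁻¹' H k) fun k => R.toEquiv '' H k))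
    (by
      rintro (k | k | k)
      · exact hH k
      · exact R.toEquiv.measurable (hH k)
      · exact R.toEquiv.measurableSet_image.2 (hH k))
    (K := K) (M := m) (n := n) hm0 (by omega) (by omega) (p := p)
    (by
      rintro (_ | i)
      · exact P.c_nonneg
      · exact add_nonneg (P.coeff_nonneg i) (by split_ifs <;> simp [hr0]))
    (by
      rw [Fintype.sum_option]
      have := hite fun _ => 1
      simp only [mul_one] at this
      simp only [p, Option.elim]
      rw [this, hr]
      ring)
  set δ : ℝ := 1 / (n - K : ℝ) + 1 / m with hδ
  have hδ2 : δ ≤ 2 / m := by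
    have h1 : (m : ℝ) ≤ n - K := by
      rw [le_sub_iff_add_le']; exact_mod_cast hn
    have := one_div_le_one_div_of_le hmR h1
    rw [hδ, show (2 : ℝ) / m = 1 / m + 1 / m by ring]
    linarith
  have hKδ : (K + 1) * δ < ε / 8 := by
    refine (mul_le_mul_of_nonneg_left hδ2 (by positivity)).trans_lt ?_
    rw [div_lt_iff₀ hε] at hm
    rw [mul_div_assoc', div_lt_div_iff₀ hmR (by norm_num)]
    linarith
  have hδ0 : 0 ≤ δ := by
    have : (K : ℝ) ≤ n := by exact_mod_cast (by omega : K ≤ n)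
    have := sub_nonneg.2 this
    positivity
  have hK0R : (0 : ℝ) ≤ K * δ := by positivity
  refine ⟨Q, fun k => ⟨?_, ?_⟩, fun k k' => ?_⟩
  · have h := hQ1 (Sum.inr (Sum.inr k)) (Sum.inl k) 1
    simp only [Sum.elim_inl, Sum.elim_inr, Function.iterate_one, Nat.cast_one, one_mul] at h
    rw [Set.preimage_image_eq _ R.toEquiv.injective, Set.inter_self] at h
    have hRm : MeasurableSet (R.toEquiv '' H k) := R.toEquiv.measurableSet_image.2 (hH k)
    have h1 : Q.toEquiv ⁻¹' ((Q.toEquiv '' H k) ∆ (R.toEquiv '' H k)) =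
        H k ∆ (Q.toEquiv ⁻¹' (R.toEquiv '' H k)) := by
      rw [Set.preimage_symmDiff, Set.preimage_image_eq _ Q.toEquiv.injective]
    have hQm : MeasurableSet (Q.toEquiv '' H k) := Q.toEquiv.measurableSet_image.2 (hH k)
    rw [← Q.measurePreserving.measureReal_preimage (hQm.symmDiff hRm).nullMeasurableSet, h1,
      measureReal_symmDiff_eq μ (hH k) (Q.toEquiv.measurable hRm),
      Q.measurePreserving.measureReal_preimage hRm.nullMeasurableSet,
      ← R.measurePreserving.measureReal_preimage hRm.nullMeasurableSet,
      Set.preimage_image_eq _ R.toEquiv.injective, Set.inter_comm]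
    have := (abs_le.1 h).1
    linarith
  · have h := hQ1 (Sum.inl k) (Sum.inr (Sum.inl k)) 1
    simp only [Sum.elim_inl, Sum.elim_inr, Function.iterate_one, Nat.cast_one, one_mul] at h
    rw [Set.inter_self] at h
    rw [measureReal_symmDiff_eq μ (Q.toEquiv.measurable (hH k)) (R.toEquiv.measurable (hH k)),
      Q.measurePreserving.measureReal_preimage (hH k).nullMeasurableSet]
    rw [R.measurePreserving.measureReal_preimage (hH k).nullMeasurableSet] at h ⊢
    have := (abs_le.1 h).1
    linarith
  · have h := hQ2 (Sum.inl k) (Sum.inl k')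
    simp only [Sum.elim_inl, p, Option.elim] at h
    rw [hite fun i => μ.real (R.toEquiv^[i] ⁻¹' H k ∩ H k')] at h
    have h1 := P.abs_correlation_sub_le μ Q.toEquiv (H k) (H k') K
    have h2 : |∑ i ∈ Finset.range K, P.coeff i * μ.real (Q.toEquiv^[i] ⁻¹' H k ∩ H k') -
        ∑ i ∈ Finset.range K, P.coeff i * μ.real (R.toEquiv^[i] ⁻¹' H k ∩ H k')| ≤ K * δ := by
      rw [← Finset.sum_sub_distrib]
      refine (Finset.abs_sum_le_sum_abs _ _).trans ?_
      calc _ ≤ ∑ i ∈ Finset.range K, P.coeff i * (K * δ) := by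
            refine Finset.sum_le_sum fun i hi => ?_
            rw [← mul_sub, abs_mul, abs_of_nonneg (P.coeff_nonneg i)]
            refine mul_le_mul_of_nonneg_left ((hQ1 (Sum.inl k) (Sum.inl k') i).trans ?_)
              (P.coeff_nonneg i)
            exact mul_le_mul_of_nonneg_right (by exact_mod_cast (Finset.mem_range.1 hi).le) hδ0
        _ = (∑ i ∈ Finset.range K, P.coeff i) * (K * δ) := (Finset.sum_mul _ _ _).symm
        _ ≤ 1 * (K * δ) := mul_le_mul_of_nonneg_right
            ((P.sum_coeff_le K).trans (by have := P.c_nonneg; linarith)) hK0R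
        _ = _ := one_mul _
    have h3 : r * μ.real (R.toEquiv^[0] ⁻¹' H k ∩ H k') ≤ r :=
      mul_le_of_le_one_right hr0 measureReal_le_one
    have h4 : 0 ≤ r * μ.real (R.toEquiv^[0] ⁻¹' H k ∩ H k') := mul_nonneg hr0 measureReal_nonneg
    rw [← hr] at h1
    rw [abs_le] at h h1 h2
    rw [abs_lt]
    constructor <;> linarith [h.1, h.2, h1.1, h1.2, h2.1, h2.2]

end Approximation
-- Halmos' metric as convergence on all measurable sets
section HalmosConvergence

variable {α β : Type*} [MeasurableSpace α] {μ : Measure α} [IsFiniteMeasure μ]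

theorem halmosTerm_le (D : ℕ → Set α) (i : ℕ) (S T : Transformation μ) :
    halmosTerm D i S T ≤ 2 ^ i * halmosPreDist D S T := by
  have h := (summable_halmos D S T).le_tsum i
    fun j _ => mul_nonneg (by positivity) (halmosTerm_nonneg D j S T)
  have h2 := mul_le_mul_of_nonneg_left h (by positivity : (0 : ℝ) ≤ 2 ^ i)
  rwa [← mul_assoc, ← mul_pow, show (2 : ℝ) * (1 / 2) = 1 by norm_num, one_pow, one_mul] at h2

/-- Convergence to each other of two families of transformations, on every measurable set. -/
def PreimagesMerge (l : Filter β) (S T : β → α → α) (μ : Measure α) : Prop :=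
  ∀ A, MeasurableSet A → Tendsto (fun b => μ.real ((S b ⁻¹' A) ∆ (T b ⁻¹' A))) l (𝓝 0)

/-- Measure-preserving maps keep approximation errors, so the error of replacing `A` by `B` is
uniform in `b`. -/
theorem preimagesMerge_of_dense {𝒜 : Set (Set α)} (h𝒜 : μ.MeasureDense 𝒜) {l : Filter β}
    {S T : β → α → α} (hS : ∀ b, MeasurePreserving (S b) μ μ)
    (hT : ∀ b, MeasurePreserving (T b) μ μ)
    (h : ∀ B ∈ 𝒜, Tendsto (fun b => μ.real ((S b ⁻¹' B) ∆ (T b ⁻¹' B))) l (𝓝 0)) :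
    PreimagesMerge l S T μ := by
  intro A hA
  rw [Metric.tendsto_nhds]
  intro ε hε
  obtain ⟨B, hB, hi⟩ := h𝒜.approx A hA (measure_ne_top _ _) (ε / 4) (by positivity)
  have hiR : μ.real (A ∆ B) < ε / 4 := by
    rw [measureReal_def]
    exact (ENNReal.lt_ofReal_iff_toReal_lt (measure_ne_top _ _)).1 hi
  have hBm : MeasurableSet B := h𝒜.measurable _ hB
  have key : ∀ {R : α → α}, MeasurePreserving R μ μ →
      μ.real ((R ⁻¹' A) ∆ (R ⁻¹' B)) = μ.real (A ∆ B) := fun hR => by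
    rw [← Set.preimage_symmDiff, hR.measureReal_preimage (hA.symmDiff hBm).nullMeasurableSet]
  filter_upwards [(h B hB).eventually_lt_const (u := ε / 4) (by positivity)] with b hb
  rw [Real.dist_eq, sub_zero, abs_of_nonneg measureReal_nonneg]
  have h1 := measureReal_symmDiff_le (μ := μ) (s := S b ⁻¹' A) (t := S b ⁻¹' B) (T b ⁻¹' A)
  have h2 := measureReal_symmDiff_le (μ := μ) (s := S b ⁻¹' B) (t := T b ⁻¹' B) (T b ⁻¹' A)
  rw [key (hS b)] at h1
  rw [symmDiff_comm (T b ⁻¹' B), key (hT b)] at h2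
  linarith

/-- Removes the family `D` from the later arguments. Images are preimages under the inverse, and the
weighted series is handled by dominated convergence. -/
theorem tendsto_halmosPreDist_iff {D : ℕ → Set α} (hD : μ.MeasureDense (Set.range D))
    {l : Filter β} {S T : β → Transformation μ} :
    Tendsto (fun b => halmosPreDist D (S b) (T b)) l (𝓝 0) ↔
      PreimagesMerge l (fun b => (S b).toEquiv) (fun b => (T b).toEquiv) μ ∧
      PreimagesMerge l (fun b => (S b).toEquiv.symm) (fun b => (T b).toEquiv.symm) μ := by
  constructor
  · intro h
    have hi : ∀ i, Tendsto (fun b => halmosTerm D i (S b) (T b)) l (𝓝 0) := fun i =>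
      squeeze_zero (fun b => halmosTerm_nonneg D i _ _) (fun b => halmosTerm_le D i _ _)
        (by simpa using h.const_mul (2 ^ i))
    refine ⟨preimagesMerge_of_dense hD (fun b => (S b).measurePreserving)
      (fun b => (T b).measurePreserving) (Set.forall_mem_range.2 fun i => ?_),
      preimagesMerge_of_dense hD (fun b => (S b).measurePreserving_symm)
      (fun b => (T b).measurePreserving_symm) (Set.forall_mem_range.2 fun i => ?_)⟩
    · refine squeeze_zero (fun b => measureReal_nonneg) (fun b => ?_) (hi i)
      exact le_add_of_nonneg_left measureReal_nonneg
    · refine squeeze_zero (fun b => measureReal_nonneg) (fun b => ?_) (hi i)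
      unfold halmosTerm
      rw [MeasurableEquiv.image_eq_preimage_symm, MeasurableEquiv.image_eq_preimage_symm]
      exact le_add_of_nonneg_right measureReal_nonneg
  · rintro ⟨h1, h2⟩
    have hDi : ∀ i, MeasurableSet (D i) := fun i => hD.measurable _ ⟨i, rfl⟩
    have h3 : Tendsto (fun b => ∑' i : ℕ, (1 / 2 : ℝ) ^ i * halmosTerm D i (S b) (T b)) l
        (𝓝 (∑' _ : ℕ, 0)) := by
      refine tendsto_tsum_of_dominated_convergence
        (bound := fun i : ℕ => (1 / 2 : ℝ) ^ i * (μ.real Set.univ + μ.real Set.univ))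
        (summable_geometric_two.mul_right _) (fun i => ?_) (Eventually.of_forall fun b i => ?_)
      · have := ((h2 _ (hDi i)).add (h1 _ (hDi i))).const_mul ((1 / 2 : ℝ) ^ i)
        simp only [add_zero, mul_zero] at this
        refine this.congr fun b => ?_
        unfold halmosTerm
        rw [MeasurableEquiv.image_eq_preimage_symm, MeasurableEquiv.image_eq_preimage_symm]
      · rw [Real.norm_of_nonneg (mul_nonneg (by positivity) (halmosTerm_nonneg D i _ _))]
        refine mul_le_mul_of_nonneg_left ?_ (by positivity)
        exact add_le_add (measureReal_mono (Set.subset_univ _))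
          (measureReal_mono (Set.subset_univ _))
    simpa [halmosPreDist] using h3

theorem PreimagesMerge.comp {l : Filter β} {T S : β → α → α} {f g : α → α}
    (hT : ∀ b, Measurable (T b)) (hS : ∀ b, MeasurePreserving (S b) μ μ) (hf : Measurable f)
    (hTf : PreimagesMerge l T (fun _ => f) μ) (hSg : PreimagesMerge l S (fun _ => g) μ) :
    PreimagesMerge l (fun b => T b ∘ S b) (fun _ => f ∘ g) μ := by
  intro A hA
  refine squeeze_zero (fun b => measureReal_nonneg) (fun b => ?_)
    (by simpa using (hTf A hA).add (hSg _ (hf hA)))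
  have h1 := measureReal_symmDiff_le (μ := μ) (s := S b ⁻¹' (T b ⁻¹' A))
    (t := S b ⁻¹' (f ⁻¹' A)) (g ⁻¹' (f ⁻¹' A))
  rw [← Set.preimage_symmDiff, (hS b).measureReal_preimage
    ((hT b hA).symmDiff (hf hA)).nullMeasurableSet] at h1
  exact h1

theorem PreimagesMerge.iterate {l : Filter β} {T : β → α → α} {S : α → α}
    (hT : ∀ b, MeasurePreserving (T b) μ μ) (hS : Measurable S)
    (h : PreimagesMerge l T (fun _ => S) μ) (i : ℕ) :
    PreimagesMerge l (fun b => (T b)^[i]) (fun _ => S^[i]) μ := by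
  induction i with
  | zero => intro A _; simpa using tendsto_const_nhds
  | succ i ih =>
    intro A hA
    exact PreimagesMerge.comp (fun b => (hT b).measurable.iterate i) hT (hS.iterate i) ih h A hA

end HalmosConvergence

/-! ### The deviation and its continuity in mean -/

section Deviation

variable {X : Type*} [MeasurableSpace X] {μ : Measure X} [IsProbabilityMeasure μ]

theorem skewProduct_id_iterate (T : MeasurableFamily μ) (i : ℕ) (p : X × X) :
    (skewProduct (Transformation.id μ) T).toEquiv^[i] p = (p.1, (T.fiber p.1).toEquiv^[i] p.2) := by
  induction i generalizing p with
  | zero => rfl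
  | succ i ih => rw [Function.iterate_succ_apply, ih]; rfl

theorem MeasurableFamily.measurable_iterate (T : MeasurableFamily μ) (i : ℕ) :
    Measurable fun p : X × X => (T.fiber p.1).toEquiv^[i] p.2 := by
  have := ((skewProduct (Transformation.id μ) T).toEquiv.measurable.iterate i).snd
  simpa only [skewProduct_id_iterate] using this

theorem measurable_measureReal_prodMk {A : Set (X × X)} (hA : MeasurableSet A) :
    Measurable fun x => μ.real (Prod.mk x ⁻¹' A) :=
  (measurable_measure_prodMk_left hA).ennreal_toReal

theorem prod_real_eq_integral {A : Set (X × X)} (hA : MeasurableSet A) :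
    (μ.prod μ).real A = ∫ x, μ.real (Prod.mk x ⁻¹' A) ∂μ := by
  rw [measureReal_def, Measure.prod_apply hA]
  exact (integral_toReal (measurable_measure_prodMk_left hA).aemeasurable
    (Eventually.of_forall fun x => measure_lt_top _ _)).symm

theorem measurable_correlation_iterate (T : MeasurableFamily μ) (i : ℕ) {E F : Set X}
    (hE : MeasurableSet E) (hF : MeasurableSet F) :
    Measurable fun x => μ.real ((T.fiber x).toEquiv^[i] ⁻¹' E ∩ F) :=
  measurable_measureReal_prodMk (A := (fun p : X × X => (T.fiber p.1).toEquiv^[i] p.2) ⁻¹' E ∩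
    Prod.snd ⁻¹' F) ((T.measurable_iterate i hE).inter (measurable_snd hF))

/-- Measurability of a field of admissible functions. -/
structure MeasurableField (P : X → AdmissibleFunction) : Prop where
  c : Measurable fun x => (P x).c
  coeff : ∀ i, Measurable fun x => (P x).coeff i

theorem MeasurableField.measurable_correlation {P : X → AdmissibleFunction}
    (hP : MeasurableField P) (T : MeasurableFamily μ) {E F : Set X}
    (hE : MeasurableSet E) (hF : MeasurableSet F) :
    Measurable fun x => (P x).correlation μ (T.fiber x).toEquiv E F := by
  refine (hP.c.mul_const _).add ?_
  refine measurable_of_tendsto_metrizable (f := fun (n : ℕ) x => ∑ i ∈ Finset.range n,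
    (P x).coeff i * μ.real ((T.fiber x).toEquiv^[i] ⁻¹' E ∩ F)) (fun n => ?_) ?_
  · exact Finset.measurable_sum _ fun i _ =>
      (hP.coeff i).mul (measurable_correlation_iterate T i hE hF)
  · exact tendsto_pi_nhds.2 fun x =>
      ((P x).summable_correlation μ (T.fiber x).toEquiv E F).hasSum.tendsto_sum_nat

/-- The error at `x` of the approximation of `T_xⁿ` by `P_x(T_x)`, for the matrix coefficient at the
indicator functions of `E` and `F`. -/
noncomputable def deviation (P : X → AdmissibleFunction) (T : MeasurableFamily μ) (n : ℕ)
    (E F : Set X) (x : X) : ℝ :=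
  |μ.real ((T.fiber x).toEquiv^[n] ⁻¹' E ∩ F) - (P x).correlation μ (T.fiber x).toEquiv E F|

omit [IsProbabilityMeasure μ] in
theorem deviation_nonneg (P : X → AdmissibleFunction) (T : MeasurableFamily μ) (n : ℕ)
    (E F : Set X) (x : X) : 0 ≤ deviation P T n E F x :=
  abs_nonneg _

theorem deviation_le_one (P : X → AdmissibleFunction) (T : MeasurableFamily μ) (n : ℕ)
    (E F : Set X) (x : X) : deviation P T n E F x ≤ 1 := by
  have h1 := (P x).correlation_nonneg μ (T.fiber x).toEquiv E F
  have h2 := (P x).correlation_le_one μ (T.fiber x).toEquiv E F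
  have h3 : 0 ≤ μ.real ((T.fiber x).toEquiv^[n] ⁻¹' E ∩ F) := measureReal_nonneg
  have h4 : μ.real ((T.fiber x).toEquiv^[n] ⁻¹' E ∩ F) ≤ 1 := measureReal_le_one
  unfold deviation
  rw [abs_le]; constructor <;> linarith

theorem MeasurableField.measurable_deviation {P : X → AdmissibleFunction}
    (hP : MeasurableField P) (T : MeasurableFamily μ) (n : ℕ) {E F : Set X}
    (hE : MeasurableSet E) (hF : MeasurableSet F) : Measurable (deviation P T n E F) :=
  ((measurable_correlation_iterate T n hE hF).sub (hP.measurable_correlation T hE hF)).abs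

theorem MeasurableField.integrable_deviation {P : X → AdmissibleFunction}
    (hP : MeasurableField P) (T : MeasurableFamily μ) (n : ℕ) {E F : Set X}
    (hE : MeasurableSet E) (hF : MeasurableSet F) : Integrable (deviation P T n E F) μ :=
  Integrable.of_bound (hP.measurable_deviation T n hE hF).aestronglyMeasurable 1
    (Eventually.of_forall fun x => by
      rw [Real.norm_of_nonneg (deviation_nonneg P T n E F x)]; exact deviation_le_one P T n E F x)

theorem abs_measureReal_inter_sub_le (A B F : Set X) :
    |μ.real (A ∩ F) - μ.real (B ∩ F)| ≤ μ.real (A ∆ B) := by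
  have key : ∀ {A B : Set X}, μ.real (A ∩ F) ≤ μ.real (B ∩ F) + μ.real (A ∆ B) := by
    intro A B
    refine (measureReal_mono ?_).trans (measureReal_union_le _ _)
    intro x hx
    by_cases hxB : x ∈ B
    · exact Or.inl ⟨hxB, hx.2⟩
    · exact Or.inr (Or.inl ⟨hx.1, hxB⟩)
  have h1 := key (A := A) (B := B)
  have h2 := key (A := B) (B := A)
  rw [symmDiff_comm] at h2
  rw [abs_le]; constructor <;> linarith

/-- The change of the deviation at `x` is at most the fibrewise symmetric differences `d i` for `i =
n` and `i < K`, plus twice the coefficient tail `r K x`. The integral of `d i` is a symmetric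
difference of preimages of `univ ×ˢ E` under iterated skew products, hence tends to zero. The tail
does not depend on `b`, and its integral vanishes as `K` grows. -/
theorem tendsto_integral_deviation {D : ℕ → Set (X × X)}
    (hD : (μ.prod μ).MeasureDense (Set.range D)) {P : X → AdmissibleFunction}
    (hP : MeasurableField P) {β : Type*} {l : Filter β} {S : β → MeasurableFamily μ}
    {T : MeasurableFamily μ}
    (h : Tendsto (fun b => halmosPreDist D (skewProduct (Transformation.id μ) (S b))
      (skewProduct (Transformation.id μ) T)) l (𝓝 0)) (n : ℕ) {E F : Set X}
    (hE : MeasurableSet E) (hF : MeasurableSet F) :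
    Tendsto (fun b => ∫ x, deviation P (S b) n E F x ∂μ) l
      (𝓝 (∫ x, deviation P T n E F x ∂μ)) := by
  let d : ℕ → β → X → ℝ := fun i b x =>
    μ.real ((((S b).fiber x).toEquiv^[i] ⁻¹' E) ∆ ((T.fiber x).toEquiv^[i] ⁻¹' E))
  have hset : ∀ i b, MeasurableSet
      (((fun p : X × X => ((S b).fiber p.1).toEquiv^[i] p.2) ⁻¹' E) ∆
        ((fun p : X × X => (T.fiber p.1).toEquiv^[i] p.2) ⁻¹' E)) := fun i b =>
    ((S b).measurable_iterate i hE).symmDiff (T.measurable_iterate i hE)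
  have hdm : ∀ i b, Measurable (d i b) := fun i b => measurable_measureReal_prodMk (hset i b)
  have hd0 : ∀ i b x, 0 ≤ d i b x := fun i b x => measureReal_nonneg
  have hdi : ∀ i b, Integrable (d i b) μ := fun i b =>
    Integrable.of_bound (hdm i b).aestronglyMeasurable 1 (Eventually.of_forall fun x => by
      rw [Real.norm_of_nonneg (hd0 i b x)]; exact measureReal_le_one)
  have hdlim : ∀ i, Tendsto (fun b => ∫ x, d i b x ∂μ) l (𝓝 0) := by
    intro i
    have h1 := (((tendsto_halmosPreDist_iff hD).1 h).1).iterate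
      (fun b => (skewProduct (Transformation.id μ) (S b)).measurePreserving)
      (skewProduct (Transformation.id μ) T).toEquiv.measurable i (Set.univ ×ˢ E)
      (MeasurableSet.univ.prod hE)
    refine h1.congr fun b => ?_
    refine Eq.trans ?_ (prod_real_eq_integral (hset i b))
    congr 2 <;>
    · ext p
      simp only [Set.mem_preimage, skewProduct_id_iterate, Set.mem_prod, Set.mem_univ, true_and]
  let r : ℕ → X → ℝ := fun K x => 1 - (P x).c - ∑ i ∈ Finset.range K, (P x).coeff i
  have hrm : ∀ K, Measurable (r K) := fun K =>
    (hP.c.const_sub 1).sub (Finset.measurable_sum _ fun i _ => hP.coeff i)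
  have hr0 : ∀ K x, 0 ≤ r K x := fun K x => sub_nonneg.2 ((P x).sum_coeff_le K)
  have hr1 : ∀ K x, r K x ≤ 1 := fun K x => by
    have h1 := (P x).c_nonneg
    have h2 := Finset.sum_nonneg fun i (_ : i ∈ Finset.range K) => (P x).coeff_nonneg i
    simp only [r]; linarith
  have hri : ∀ K, Integrable (r K) μ := fun K =>
    Integrable.of_bound (hrm K).aestronglyMeasurable 1 (Eventually.of_forall fun x => by
      rw [Real.norm_of_nonneg (hr0 K x)]; exact hr1 K x)
  have hrlim : Tendsto (fun K => ∫ x, r K x ∂μ) atTop (𝓝 0) := by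
    have := tendsto_integral_of_dominated_convergence (μ := μ) (F := r) (f := fun _ => (0 : ℝ))
      (fun _ => 1) (fun K => (hrm K).aestronglyMeasurable) (integrable_const _)
      (fun K => Eventually.of_forall fun x => by
        rw [Real.norm_of_nonneg (hr0 K x)]; exact hr1 K x)
      (Eventually.of_forall fun x => by
        simpa [r] using (P x).hasSum_coeff.tendsto_sum_nat.const_sub (1 - (P x).c))
    simpa using this
  have hbound : ∀ K b x, |deviation P (S b) n E F x - deviation P T n E F x| ≤
      d n b x + ∑ i ∈ Finset.range K, d i b x + 2 * r K x := by
    intro K b x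
    have e1 := abs_measureReal_inter_sub_le (μ := μ)
      (((S b).fiber x).toEquiv^[n] ⁻¹' E) ((T.fiber x).toEquiv^[n] ⁻¹' E) F
    have e2 := (P x).abs_correlation_sub_le μ ((S b).fiber x).toEquiv E F K
    have e3 := (P x).abs_correlation_sub_le μ (T.fiber x).toEquiv E F K
    have e4 : |∑ i ∈ Finset.range K, (P x).coeff i *
          μ.real (((S b).fiber x).toEquiv^[i] ⁻¹' E ∩ F) -
        ∑ i ∈ Finset.range K, (P x).coeff i * μ.real ((T.fiber x).toEquiv^[i] ⁻¹' E ∩ F)| ≤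
        ∑ i ∈ Finset.range K, d i b x := by
      rw [← Finset.sum_sub_distrib]
      refine (Finset.abs_sum_le_sum_abs _ _).trans (Finset.sum_le_sum fun i _ => ?_)
      rw [← mul_sub, abs_mul, abs_of_nonneg ((P x).coeff_nonneg i)]
      have hc : (P x).coeff i ≤ 1 := by
        have := le_hasSum (P x).hasSum_coeff i fun j _ => (P x).coeff_nonneg j
        have := (P x).c_nonneg
        linarith
      have e5 := abs_measureReal_inter_sub_le (μ := μ)
        (((S b).fiber x).toEquiv^[i] ⁻¹' E) ((T.fiber x).toEquiv^[i] ⁻¹' E) F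
      calc _ ≤ 1 * _ := mul_le_mul_of_nonneg_right hc (abs_nonneg _)
        _ ≤ _ := by rw [one_mul]; exact e5
    refine (abs_abs_sub_abs_le_abs_sub _ _).trans ?_
    change |_| ≤ d n b x at e1
    change |_| ≤ r K x at e2
    change |_| ≤ r K x at e3
    rw [abs_le] at e1 e2 e3 e4 ⊢
    constructor <;> linarith [e1.1, e1.2, e2.1, e2.2, e3.1, e3.2, e4.1, e4.2]
  rw [Metric.tendsto_nhds]
  intro ε hε
  obtain ⟨K, hK⟩ := (hrlim.eventually_lt_const (u := ε / 4) (by positivity)).exists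
  have hfin : Tendsto (fun b => ∫ x, d n b x ∂μ + ∑ i ∈ Finset.range K, ∫ x, d i b x ∂μ) l
      (𝓝 0) := by
    simpa using (hdlim n).add (tendsto_finsetSum (Finset.range K) fun i _ => hdlim i)
  filter_upwards [hfin.eventually_lt_const (u := ε / 2) (by positivity)] with b hb
  rw [Real.dist_eq, ← integral_sub (hP.integrable_deviation _ n hE hF)
    (hP.integrable_deviation _ n hE hF)]
  have hsi : Integrable (fun x => ∑ i ∈ Finset.range K, d i b x) μ :=
    integrable_finsetSum _ fun i _ => hdi i b
  calc _ ≤ ∫ x, |deviation P (S b) n E F x - deviation P T n E F x| ∂μ :=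
        abs_integral_le_integral_abs
    _ ≤ ∫ x, (d n b x + ∑ i ∈ Finset.range K, d i b x + 2 * r K x) ∂μ :=
        integral_mono ((hP.integrable_deviation _ n hE hF).sub
          (hP.integrable_deviation _ n hE hF)).abs
          (((hdi n b).add hsi).add ((hri K).const_mul 2)) (hbound K b)
    _ = ∫ x, d n b x ∂μ + ∑ i ∈ Finset.range K, ∫ x, d i b x ∂μ + 2 * ∫ x, r K x ∂μ := by
        have e1 := integral_add ((hdi n b).add hsi) ((hri K).const_mul 2)
        have e2 := integral_add (hdi n b) hsi
        rw [integral_finsetSum _ fun i _ => hdi i b] at e2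
        rw [integral_const_mul] at e1
        rw [← e2]
        exact e1
    _ < ε := by linarith

end Deviation
-- Limits of Cauchy sequences of measure-preserving maps
section Limit

variable {α : Type*} [MeasurableSpace α] {μ : Measure α} [IsFiniteMeasure μ]

theorem tendsto_measureReal_of_ae_eventually_mem_iff {A : ℕ → Set α} {B : Set α}
    (hA : ∀ k, MeasurableSet (A k)) (hB : MeasurableSet B)
    (h : ∀ᵐ x ∂μ, ∀ᶠ k in atTop, x ∈ A k ↔ x ∈ B) :
    Tendsto (fun k => μ.real (A k)) atTop (𝓝 (μ.real B)) :=
  (ENNReal.tendsto_toReal (measure_ne_top _ _)).comp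
    (tendsto_measure_of_ae_tendsto_indicator_of_isFiniteMeasure atTop hB hA h)

theorem ae_eq_of_forall_measureReal_symmDiff_eq_zero [MeasurableSpace.CountablySeparated α]
    {f g : α → α} (h : ∀ A, MeasurableSet A → μ.real ((f ⁻¹' A) ∆ (g ⁻¹' A)) = 0) :
    f =ᵐ[μ] g :=
  EventuallyEq.of_forall_separating_preimage MeasurableSet fun A hA =>
    measure_symmDiff_eq_zero_iff.1 ((measureReal_eq_zero_iff (measure_ne_top _ _)).1 (h A hA))

/-- The sets whose membership stabilizes to that of `f p` form an algebra. So stabilization passes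
from generators to a generating algebra, which is both a π-system determining the measure and dense
in the measure algebra. -/
theorem measurePreserving_of_ae_eventually {t : ℕ → α → α} (ht : ∀ k, MeasurePreserving (t k) μ μ)
    {f : α → α} (hf : Measurable f) {𝒢 : Set (Set α)} (h𝒢m : ∀ A ∈ 𝒢, MeasurableSet A)
    (h𝒢 : ‹MeasurableSpace α› = MeasurableSpace.generateFrom 𝒢)
    (h : ∀ A ∈ 𝒢, ∀ᵐ p ∂μ, ∀ᶠ k in atTop, t k p ∈ A ↔ f p ∈ A) :
    MeasurePreserving f μ μ ∧ PreimagesMerge atTop t (fun _ => f) μ := by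
  let 𝒜 : Set (Set α) := {A | MeasurableSet A ∧ ∀ᵐ p ∂μ, ∀ᶠ k in atTop, t k p ∈ A ↔ f p ∈ A}
  have halg : IsSetAlgebra 𝒜 := by
    refine ⟨⟨MeasurableSet.empty, by simp⟩, fun A hA => ⟨hA.1.compl, ?_⟩,
      fun A B hA hB => ⟨hA.1.union hB.1, ?_⟩⟩
    · filter_upwards [hA.2] with p hp
      filter_upwards [hp] with k hk
      simp only [Set.mem_compl_iff, hk]
    · filter_upwards [hA.2, hB.2] with p hp hq
      filter_upwards [hp, hq] with k hk hk'
      simp only [Set.mem_union, hk, hk']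
  have hgen : ‹MeasurableSpace α› = MeasurableSpace.generateFrom 𝒜 := by
    refine le_antisymm ?_ (MeasurableSpace.generateFrom_le fun A hA => hA.1)
    conv_lhs => rw [h𝒢]
    exact MeasurableSpace.generateFrom_mono fun A hA => ⟨h𝒢m A hA, h A hA⟩
  have hfp : MeasurePreserving f μ μ := by
    refine ⟨hf, ext_of_generate_finite 𝒜 hgen (fun s hs u hu _ => halg.inter_mem hs hu)
      (fun A hA => ?_) ?_⟩
    · rw [Measure.map_apply hf hA.1]
      have h1 := tendsto_measure_of_ae_tendsto_indicator_of_isFiniteMeasure (μ := μ) atTop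
        (hf hA.1) (fun k => (ht k).measurable hA.1) hA.2
      simp only [(ht _).measure_preimage hA.1.nullMeasurableSet] at h1
      exact tendsto_nhds_unique h1 tendsto_const_nhds
    · rw [Measure.map_apply hf MeasurableSet.univ, Set.preimage_univ]
  refine ⟨hfp, preimagesMerge_of_dense
    (Measure.MeasureDense.of_generateFrom_isSetAlgebra_finite μ halg hgen) ht (fun _ => hfp)
    fun A hA => ?_⟩
  have h1 := tendsto_measureReal_of_ae_eventually_mem_iff (μ := μ) (B := ∅)
    (A := fun k => (t k ⁻¹' A) ∆ (f ⁻¹' A))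
    (fun k => ((ht k).measurable hA.1).symmDiff (hf hA.1)) MeasurableSet.empty (by
      filter_upwards [hA.2] with p hp
      filter_upwards [hp] with k hk
      simp only [Set.mem_symmDiff, Set.mem_preimage, hk, Set.mem_empty_iff_false, iff_false]
      tauto)
  simpa using h1

theorem PreimagesMerge.of_subsequence {T : ℕ → α → α} {f : α → α}
    (hT : PreimagesMerge (atTop : Filter (ℕ × ℕ)) (fun b => T b.1) (fun b => T b.2) μ)
    {φ : ℕ → ℕ} (hφ : StrictMono φ) (h : PreimagesMerge atTop (fun k => T (φ k)) (fun _ => f) μ) :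
    PreimagesMerge atTop T (fun _ => f) μ := by
  intro A hA
  have h1 : Tendsto (fun k : ℕ => (k, φ k)) atTop atTop := by
    rw [← prod_atTop_atTop_eq]
    exact tendsto_id.prodMk hφ.tendsto_atTop
  refine squeeze_zero (fun b => measureReal_nonneg) (fun b => ?_)
    (by simpa using ((hT A hA).comp h1).add (h A hA))
  exact measureReal_symmDiff_le _

variable [StandardBorelSpace α]

/-- Code points by binary sequences. Along a fast subsequence Borel–Cantelli makes every bit of the
image of almost every point eventually constant, and decoding the limiting bits gives `f`. The
Cauchy property returns to the whole sequence. -/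
theorem exists_limit_of_preimagesMerge [NullSingletonClass μ] [NeZero μ] {T : ℕ → α → α}
    (hTp : ∀ k, MeasurePreserving (T k) μ μ)
    (hT : PreimagesMerge (atTop : Filter (ℕ × ℕ)) (fun b => T b.1) (fun b => T b.2) μ) :
    ∃ f : α → α, MeasurePreserving f μ μ ∧ PreimagesMerge atTop T (fun _ => f) μ := by
  classical
  have hunc : ¬ Countable α := fun hc => by
    have : μ Set.univ = 0 := Set.countable_univ.measure_zero μ
    exact NeZero.ne μ (Measure.measure_univ_eq_zero.1 this)
  let e : α ≃ᵐ (ℕ → Bool) := PolishSpace.measurableEquivNatBoolOfNotCountable hunc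
  let A : ℕ → Set α := fun i => {x | e x i = true}
  have hA : ∀ i, MeasurableSet (A i) := fun i =>
    ((measurable_pi_apply i).comp e.measurable) (measurableSet_singleton true)
  have hAgen : ‹MeasurableSpace α› = MeasurableSpace.generateFrom (Set.range A) := by
    refine le_antisymm ?_ (MeasurableSpace.generateFrom_le (Set.forall_mem_range.2 hA))
    have h1 : @Measurable α (ℕ → Bool) (MeasurableSpace.generateFrom (Set.range A)) _ e := by
      refine @measurable_pi_lambda _ _ _ (MeasurableSpace.generateFrom (Set.range A)) _ _ fun i =>
        @measurable_to_bool _ (MeasurableSpace.generateFrom (Set.range A)) _ ?_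
      exact MeasurableSpace.measurableSet_generateFrom ⟨i, rfl⟩
    intro s hs
    have h2 : MeasurableSet (e.symm ⁻¹' s) := e.symm.measurable hs
    have h3 := h1 h2
    rwa [← Set.preimage_comp, e.symm_comp_self, Set.preimage_id] at h3
  obtain ⟨φ, hφ, hφ'⟩ := extraction_forall_of_eventually'
    (P := fun k N => ∀ l ≥ N, ∀ l' ≥ N, ∀ i < k,
      μ.real ((T l ⁻¹' A i) ∆ (T l' ⁻¹' A i)) < (1 / 2) ^ k) (by
      intro k
      have h1 : ∀ᶠ b : ℕ × ℕ in atTop, ∀ i ∈ Finset.range k,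
          μ.real ((T b.1 ⁻¹' A i) ∆ (T b.2 ⁻¹' A i)) < (1 / 2) ^ k :=
        (Finset.eventually_all _).2 fun i _ =>
          (hT (A i) (hA i)).eventually_lt_const (by positivity)
      obtain ⟨N, hN⟩ := eventually_atTop_prod_self.1 h1
      exact ⟨N, fun m hm l hl l' hl' i hi => hN l l' (hm.trans hl) (hm.trans hl') i
        (Finset.mem_range.2 hi)⟩)
  let t : ℕ → α → α := fun k => T (φ k)
  have htp : ∀ k, MeasurePreserving (t k) μ μ := fun k => hTp _
  have hconst : ∀ᵐ p ∂μ, ∀ i, ∀ᶠ k in atTop, t k p ∈ A i ↔ t (k + 1) p ∈ A i := by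
    refine ae_all_iff.2 fun i => ?_
    -- The extraction controls bit `i` only at stages `k > i`; earlier stages are discarded.
    let s : ℕ → Set α := fun k => if i < k then (t k ⁻¹' A i) ∆ (t (k + 1) ⁻¹' A i) else ∅
    have hs : ∑' k, μ (s k) ≠ ∞ := by
      have h1 : ∀ k, μ (s k) ≤ ENNReal.ofReal ((1 / 2) ^ k) := by
        intro k
        by_cases hk : i < k
        · simp only [s, hk, if_true]
          rw [← ofReal_measureReal]
          exact ENNReal.ofReal_le_ofReal
            (hφ' k (φ k) le_rfl (φ (k + 1)) (hφ.monotone k.le_succ) i hk).le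
        · simp only [s, hk, if_false, measure_empty, zero_le]
      refine ne_top_of_le_ne_top ?_ (ENNReal.tsum_le_tsum h1)
      rw [← ENNReal.ofReal_tsum_of_nonneg (fun k => by positivity) summable_geometric_two]
      exact ENNReal.ofReal_ne_top
    filter_upwards [ae_eventually_notMem hs] with p hp
    filter_upwards [hp, eventually_gt_atTop i] with k hk hik
    simp only [s, hik, if_true, Set.mem_symmDiff, Set.mem_preimage] at hk
    tauto
  let f : α → α := fun p => e.symm fun i => decide (∀ᶠ k in atTop, t k p ∈ A i)
  have hfm : Measurable f := by
    refine e.symm.measurable.comp (measurable_pi_lambda _ fun i => measurable_to_bool ?_)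
    have h1 : MeasurableSet (⋃ N : ℕ, ⋂ k ≥ N, t k ⁻¹' A i) :=
      MeasurableSet.iUnion fun N => MeasurableSet.iInter fun k => MeasurableSet.iInter fun _ =>
        (htp k).measurable (hA i)
    convert h1 using 1
    ext p
    simp [eventually_atTop]
  have hfA : ∀ p i, f p ∈ A i ↔ ∀ᶠ k in atTop, t k p ∈ A i := by
    intro p i
    simp [f, A]
  have hlim : ∀ᵐ p ∂μ, ∀ i, ∀ᶠ k in atTop, t k p ∈ A i ↔ f p ∈ A i := by
    filter_upwards [hconst] with p hp i
    obtain ⟨N, hN⟩ := eventually_atTop.1 (hp i)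
    have h1 : ∀ k ≥ N, (t k p ∈ A i ↔ t N p ∈ A i) := fun k hk => by
      induction k, hk using Nat.le_induction with
      | base => rfl
      | succ k hk ih => rw [← hN k hk, ih]
    have h2 : f p ∈ A i ↔ t N p ∈ A i := by
      rw [hfA]
      constructor
      · intro h
        obtain ⟨k, hk, hk'⟩ := (h.and (eventually_ge_atTop N)).exists
        exact (h1 k hk').1 hk
      · intro h
        filter_upwards [eventually_ge_atTop N] with k hk using (h1 k hk).2 h
    filter_upwards [eventually_ge_atTop N] with k hk
    rw [h1 k hk, h2]
  obtain ⟨h1, h2⟩ := measurePreserving_of_ae_eventually htp hfm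
    (Set.forall_mem_range.2 hA) hAgen
    (Set.forall_mem_range.2 fun i => by filter_upwards [hlim] with p hp using hp i)
  exact ⟨f, h1, hT.of_subsequence hφ h2⟩

/-- The compositions are constantly the identity and also merge with `f ∘ g`; limits are unique
almost everywhere. -/
theorem ae_leftInverse_of_preimagesMerge {T S : ℕ → α → α} (hT : ∀ k, Measurable (T k))
    (hS : ∀ k, MeasurePreserving (S k) μ μ) (hTS : ∀ k p, T k (S k p) = p) {f g : α → α}
    (hf : Measurable f) (hTf : PreimagesMerge atTop T (fun _ => f) μ)
    (hSg : PreimagesMerge atTop S (fun _ => g) μ) : ∀ᵐ p ∂μ, f (g p) = p := by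
  have h1 := hTf.comp hT hS hf hSg
  have h2 : ∀ k, T k ∘ S k = id := fun k => funext (hTS k)
  simp only [h2] at h1
  have h3 : id =ᵐ[μ] f ∘ g := ae_eq_of_forall_measureReal_symmDiff_eq_zero fun A hA =>
    tendsto_nhds_unique tendsto_const_nhds (h1 A hA)
  filter_upwards [h3] with p hp using hp.symm

end Limit

/-! ### Disintegrating a transformation over the identity -/

section Fiberwise

variable {X : Type*} [MeasurableSpace X] [StandardBorelSpace X] {μ : Measure X}
  [IsProbabilityMeasure μ]

/-- A transformation of `X × X` over the identity is a skew product, up to null sets. -/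
theorem exists_measurableFamily_of_fst_eq (R : Transformation (μ.prod μ))
    (h : ∀ p, (R.toEquiv p).1 = p.1) (h' : ∀ p, (R.toEquiv.symm p).1 = p.1) :
    ∃ T : MeasurableFamily μ, (skewProduct (Transformation.id μ) T) ≈ R := by
  classical
  let E : X → X ≃ᵐ X := fun x =>
    { toFun := fun y => (R.toEquiv (x, y)).2
      invFun := fun y => (R.toEquiv.symm (x, y)).2
      left_inv := fun y => by
        have h1 : (x, (R.toEquiv (x, y)).2) = R.toEquiv (x, y) := Prod.ext (h (x, y)).symm rfl
        simp only [h1, MeasurableEquiv.symm_apply_apply]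
      right_inv := fun y => by
        have h1 : (x, (R.toEquiv.symm (x, y)).2) = R.toEquiv.symm (x, y) :=
          Prod.ext (h' (x, y)).symm rfl
        simp only [h1, MeasurableEquiv.apply_symm_apply]
      measurable_toFun := (R.toEquiv.measurable.comp measurable_prodMk_left).snd
      measurable_invFun := (R.toEquiv.symm.measurable.comp measurable_prodMk_left).snd }
  let 𝒜 : Set (Set X) := generateSetAlgebra (MeasurableSpace.countableGeneratingSet X)
  have h𝒜c : 𝒜.Countable :=
    countable_generateSetAlgebra MeasurableSpace.countable_countableGeneratingSet
  have h𝒜g : ‹MeasurableSpace X› = MeasurableSpace.generateFrom 𝒜 := by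
    rw [generateFrom_generateSetAlgebra_eq, MeasurableSpace.generateFrom_countableGeneratingSet]
  have h𝒜m : ∀ A ∈ 𝒜, MeasurableSet A := fun A hA => by
    rw [h𝒜g]; exact MeasurableSpace.measurableSet_generateFrom hA
  -- Testing on a countable generating algebra keeps the set of measure-preserving fibres
  -- measurable; elsewhere the identity is used.
  let Good : Set X := ⋂ A ∈ 𝒜, {x | μ (E x ⁻¹' A) = μ A}
  have hmeas : ∀ A, MeasurableSet A → Measurable fun x => μ (E x ⁻¹' A) := fun A hA =>
    measurable_measure_prodMk_left (R.toEquiv.measurable (measurable_snd hA))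
  have hGm : MeasurableSet Good := MeasurableSet.biInter h𝒜c fun A hA =>
    (hmeas A (h𝒜m A hA)) (measurableSet_singleton _)
  have hGp : ∀ x ∈ Good, MeasurePreserving (E x) μ μ := by
    intro x hx
    refine ⟨(E x).measurable, ext_of_generate_finite 𝒜 h𝒜g
      (fun s hs u hu _ => isSetAlgebra_generateSetAlgebra.inter_mem hs hu) (fun A hA => ?_) ?_⟩
    · rw [Measure.map_apply (E x).measurable (h𝒜m A hA)]
      exact Set.mem_iInter₂.1 hx A hA
    · rw [Measure.map_apply (E x).measurable MeasurableSet.univ, Set.preimage_univ]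
  have hGae : ∀ᵐ x ∂μ, x ∈ Good := by
    simp only [Good, Set.mem_iInter₂]
    refine (ae_ball_iff h𝒜c).2 fun A hA => ?_
    have hAm := h𝒜m A hA
    -- Integrating over `B` gives the measure of the `R`-preimage of `B ×ˢ A`, because `R` fixes the
    -- first coordinate.
    refine ae_eq_of_forall_setLIntegral_eq_of_sigmaFinite (hmeas A hAm) measurable_const
      fun B hB _ => ?_
    have h1 := R.measurePreserving.measure_preimage (hB.prod hAm).nullMeasurableSet
    rw [Measure.prod_prod, Measure.prod_apply (R.toEquiv.measurable (hB.prod hAm))] at h1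
    rw [setLIntegral_const, mul_comm, ← h1, ← lintegral_indicator hB]
    refine lintegral_congr fun x => ?_
    by_cases hx : x ∈ B
    · rw [Set.indicator_of_mem hx]
      congr 1
      ext y
      simp [E, h, hx]
    · rw [Set.indicator_of_notMem hx]
      have : Prod.mk x ⁻¹' (R.toEquiv ⁻¹' B ×ˢ A) = ∅ := by
        ext y
        simp [h, hx]
      rw [this, measure_empty]
  let T : X → Transformation μ := fun x =>
    if hx : x ∈ Good then ⟨E x, hGp x hx⟩ else Transformation.id μ
  have hT : ∀ x ∈ Good, (T x).toEquiv = E x := fun x hx => by simp only [T, hx, dif_pos]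
  have hT' : ∀ x ∉ Good, (T x).toEquiv = MeasurableEquiv.refl X := fun x hx => by
    simp only [T, hx, dif_neg, not_false_iff]; rfl
  have hGm' : MeasurableSet {p : X × X | p.1 ∈ Good} := measurable_fst hGm
  refine ⟨⟨T, ?_, ?_⟩, ?_⟩
  · have : (fun p : X × X => (T p.1).toEquiv p.2) =
        fun p => if p.1 ∈ Good then (R.toEquiv p).2 else p.2 := by
      ext p
      by_cases hp : p.1 ∈ Good
      · rw [hT _ hp, if_pos hp]; rfl
      · rw [hT' _ hp, if_neg hp]; rfl
    rw [this]
    exact Measurable.ite hGm' R.toEquiv.measurable.snd measurable_snd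
  · have : (fun p : X × X => (T p.1).toEquiv.symm p.2) =
        fun p => if p.1 ∈ Good then (R.toEquiv.symm p).2 else p.2 := by
      ext p
      by_cases hp : p.1 ∈ Good
      · rw [hT _ hp, if_pos hp]; rfl
      · rw [hT' _ hp, if_neg hp]; rfl
    rw [this]
    exact Measurable.ite hGm' R.toEquiv.symm.measurable.snd measurable_snd
  · have h1 : ∀ᵐ p ∂(μ.prod μ), p.1 ∈ Good :=
      Measure.quasiMeasurePreserving_fst.ae hGae
    change ∀ᵐ p ∂(μ.prod μ), _
    filter_upwards [h1] with p hp
    change (p.1, (T p.1).toEquiv p.2) = R.toEquiv p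
    rw [hT _ hp]
    exact Prod.ext (h p).symm rfl

end Fiberwise
-- Completeness of the space of extensions of the identity
section Completeness

variable {X : Type*} [MeasurableSpace X] [StandardBorelSpace X] {μ : Measure X}
  [IsProbabilityMeasure μ] [NullSingletonClass μ]

omit [NullSingletonClass μ] in
theorem ae_fst_eq_of_preimagesMerge {T : ℕ → X × X → X × X} (hT : ∀ k p, (T k p).1 = p.1)
    {f : X × X → X × X} (hTf : PreimagesMerge atTop T (fun _ => f) (μ.prod μ)) :
    ∀ᵐ p ∂(μ.prod μ), (f p).1 = p.1 := by
  have h : Prod.fst =ᵐ[μ.prod μ] fun p => (f p).1 :=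
    EventuallyEq.of_forall_separating_preimage MeasurableSet fun A hA => by
      have h1 := hTf (A ×ˢ Set.univ) (hA.prod MeasurableSet.univ)
      have h2 : ∀ k, T k ⁻¹' (A ×ˢ Set.univ) = Prod.fst ⁻¹' A := fun k => by ext p; simp [hT]
      have h3 : f ⁻¹' (A ×ˢ Set.univ) = (fun p => (f p).1) ⁻¹' A := by ext p; simp
      simp only [h2, h3] at h1
      exact measure_symmDiff_eq_zero_iff.1 ((measureReal_eq_zero_iff (measure_ne_top _ _)).1
        (tendsto_nhds_unique tendsto_const_nhds h1))
  filter_upwards [h] with p hp using hp.symm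

omit [NullSingletonClass μ] in
-- Force the first coordinate to be fixed everywhere before making the pair strictly invertible; the
-- second correction takes values `f' p` or `p` and keeps this, so the result splits into fibres.
theorem exists_measurableFamily_ae_eq {f g : X × X → X × X}
    (hf : MeasurePreserving f (μ.prod μ) (μ.prod μ))
    (hg : MeasurePreserving g (μ.prod μ) (μ.prod μ))
    (hgf : ∀ᵐ p ∂(μ.prod μ), g (f p) = p) (hfg : ∀ᵐ p ∂(μ.prod μ), f (g p) = p)
    (hf1 : ∀ᵐ p ∂(μ.prod μ), (f p).1 = p.1) (hg1 : ∀ᵐ p ∂(μ.prod μ), (g p).1 = p.1) :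
    ∃ S : MeasurableFamily μ,
      (∀ᵐ p ∂(μ.prod μ), (skewProduct (Transformation.id μ) S).toEquiv p = f p) ∧
      ∀ᵐ p ∂(μ.prod μ), (skewProduct (Transformation.id μ) S).toEquiv.symm p = g p := by
  have hff : ∀ᵐ p ∂(μ.prod μ), (p.1, (f p).2) = f p := by
    filter_upwards [hf1] with p hp using Prod.ext hp.symm rfl
  have hgg : ∀ᵐ p ∂(μ.prod μ), (p.1, (g p).2) = g p := by
    filter_upwards [hg1] with p hp using Prod.ext hp.symm rfl
  have hf' : MeasurePreserving (fun p : X × X => (p.1, (f p).2)) (μ.prod μ) (μ.prod μ) :=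
    ⟨measurable_fst.prodMk hf.measurable.snd, (Measure.map_congr hff).trans hf.map_eq⟩
  have hg' : MeasurePreserving (fun p : X × X => (p.1, (g p).2)) (μ.prod μ) (μ.prod μ) :=
    ⟨measurable_fst.prodMk hg.measurable.snd, (Measure.map_congr hgg).trans hg.map_eq⟩
  obtain ⟨R, hRf, hRg, hR, hR'⟩ := exists_transformation_of_ae_inverse hf' hg'
    (by
      filter_upwards [hgf, hff, hf'.quasiMeasurePreserving.ae hgg] with p h3 h4 h5
      rw [h5, h4, h3])
    (by
      filter_upwards [hfg, hgg, hg'.quasiMeasurePreserving.ae hff] with p h3 h4 h5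
      rw [h5, h4, h3])
  obtain ⟨S, hS⟩ := exists_measurableFamily_of_fst_eq R
    (fun p => by rcases hR p with h | h <;> rw [h])
    (fun p => by rcases hR' p with h | h <;> rw [h])
  have hS' : ∀ᵐ p ∂(μ.prod μ),
      (skewProduct (Transformation.id μ) S).toEquiv p = R.toEquiv p := hS
  refine ⟨S, ?_, ?_⟩
  · filter_upwards [hS', hRf, hff] with p e1 e2 e3
    rw [e1, e2, e3]
  · filter_upwards [ae_symm_eq hS', hRg, hgg] with p e1 e2 e3
    rw [e1, e2, e3]

theorem PreimagesMerge.congr_right {α β : Type*} [MeasurableSpace α] {ν : Measure α}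
    {l : Filter β} {T : β → α → α} {f f' : α → α} (h : PreimagesMerge l T (fun _ => f) ν)
    (hf : ∀ᵐ p ∂ν, f' p = f p) : PreimagesMerge l T (fun _ => f') ν := by
  intro A hA
  have h3 : f ⁻¹' A =ᵐ[ν] f' ⁻¹' A := by
    filter_upwards [hf] with p hp
    change (f p ∈ A) = (f' p ∈ A)
    rw [hp]
  exact (h A hA).congr fun k => measureReal_congr ((ae_eq_refl _).symmDiff h3)

/-- Halmos' metric controls the inverses as well, so they too have a limit, and it inverts the limit
of the maps. -/
theorem exists_family_limit {D : ℕ → Set (X × X)} (hD : (μ.prod μ).MeasureDense (Set.range D))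
    (T : ℕ → MeasurableFamily μ)
    (hT : Tendsto (fun b : ℕ × ℕ => halmosPreDist D (skewProduct (Transformation.id μ) (T b.1))
      (skewProduct (Transformation.id μ) (T b.2))) atTop (𝓝 0)) :
    ∃ S : MeasurableFamily μ, Tendsto (fun k => halmosPreDist D
      (skewProduct (Transformation.id μ) (T k)) (skewProduct (Transformation.id μ) S))
      atTop (𝓝 0) := by
  obtain ⟨h1, h2⟩ := (tendsto_halmosPreDist_iff hD).1 hT
  have hfst : ∀ k p, ((skewProduct (Transformation.id μ) (T k)).toEquiv p).1 = p.1 :=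
    fun k p => rfl
  have hfst' : ∀ k p, ((skewProduct (Transformation.id μ) (T k)).toEquiv.symm p).1 = p.1 :=
    fun k p => rfl
  generalize hU : (fun k => skewProduct (Transformation.id μ) (T k)) = U
  have hU' : ∀ k, skewProduct (Transformation.id μ) (T k) = U k := fun k => congrFun hU k
  simp only [hU'] at h1 h2 hfst hfst' ⊢
  obtain ⟨f, hf, hUf⟩ := exists_limit_of_preimagesMerge
    (fun k => (U k).measurePreserving) h1
  obtain ⟨g, hg, hUg⟩ := exists_limit_of_preimagesMerge
    (fun k => (U k).measurePreserving_symm) h2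
  have hgf := ae_leftInverse_of_preimagesMerge (fun k => (U k).toEquiv.symm.measurable)
    (fun k => (U k).measurePreserving) (fun k p => (U k).toEquiv.symm_apply_apply p)
    hg.measurable hUg hUf
  have hfg := ae_leftInverse_of_preimagesMerge (fun k => (U k).toEquiv.measurable)
    (fun k => (U k).measurePreserving_symm) (fun k p => (U k).toEquiv.apply_symm_apply p)
    hf.measurable hUf hUg
  obtain ⟨S, hS, hS'⟩ := exists_measurableFamily_ae_eq hf hg hgf hfg
    (ae_fst_eq_of_preimagesMerge hfst hUf) (ae_fst_eq_of_preimagesMerge hfst' hUg)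
  exact ⟨S, (tendsto_halmosPreDist_iff hD).2 ⟨hUf.congr_right hS, hUg.congr_right hS'⟩⟩

theorem completeSpace_ext_id {D : ℕ → Set (X × X)}
    (hD : (μ.prod μ).MeasureDense (Set.range D)) :
    letI : PseudoMetricSpace (Aut (μ.prod μ)) := halmosMetric D
    CompleteSpace (Ext (Transformation.id μ)) := by
  let _ : PseudoMetricSpace (Aut (μ.prod μ)) := halmosMetric D
  refine Metric.complete_of_cauchySeq_tendsto fun u hu => ?_
  choose T hT using fun k => (u k).2
  have hu' : ∀ k, u k = toExt (Transformation.id μ) (T k) := fun k => Subtype.ext (hT k).symm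
  obtain ⟨S, hS⟩ := exists_family_limit hD T (by
    have h := cauchySeq_iff_tendsto_dist_atTop_0.1 hu
    simp only [hu'] at h
    exact h)
  refine ⟨toExt (Transformation.id μ) S, tendsto_iff_dist_tendsto_zero.2 ?_⟩
  simp only [hu']
  exact hS

end Completeness

/-! ### Countable labels for sections and fibres -/

section Labels

variable {X : Type*} [MeasurableSpace X] {μ : Measure X} [IsProbabilityMeasure μ]

theorem exists_measurable_section_index {F : ℕ → Set X} (hF : μ.MeasureDense (Set.range F))
    {B : Set (X × X)} (hB : MeasurableSet B) {τ : ℝ} (hτ : 0 < τ) :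
    ∃ a : X → ℕ, Measurable a ∧ ∀ x, μ.real ((Prod.mk x ⁻¹' B) ∆ F (a x)) < τ := by
  classical
  have h1 : ∀ x, ∃ k, μ.real ((Prod.mk x ⁻¹' B) ∆ F k) < τ := by
    intro x
    obtain ⟨-, ⟨k, rfl⟩, hk⟩ := hF.approx _ (measurable_prodMk_left hB) (measure_ne_top _ _) τ hτ
    exact ⟨k, (ENNReal.lt_ofReal_iff_toReal_lt (measure_ne_top _ _)).1 hk⟩
  refine ⟨fun x => Nat.find (h1 x), measurable_find h1 fun k => ?_, fun x => Nat.find_spec (h1 x)⟩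
  have h2 : MeasurableSet (B ∆ (Prod.snd ⁻¹' F k)) :=
    hB.symmDiff (measurable_snd (hF.measurable _ ⟨k, rfl⟩))
  exact measurable_measureReal_prodMk h2 measurableSet_Iio

theorem exists_finset_labels {L : Type*} [Countable L] [MeasurableSpace L]
    [MeasurableSingletonClass L] {a : X → L} (ha : Measurable a) {τ : ℝ} (hτ : 0 < τ) :
    ∃ s : Finset L, μ.real (a ⁻¹' (↑s)ᶜ) < τ := by
  have h1 : HasSum (fun l => μ (a ⁻¹' {l})) 1 := by
    have := measure_eq_tsum_fiber μ ha MeasurableSet.univ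
    simp only [Set.univ_inter, measure_univ] at this
    rw [this]
    exact ENNReal.summable.hasSum
  have h2 : ∀ s : Finset L, ∑ l ∈ s, μ (a ⁻¹' {l}) = μ (a ⁻¹' ↑s) := fun s =>
    sum_measure_preimage_singleton s fun l _ => ha (measurableSet_singleton l)
  have h3 : Tendsto (fun s : Finset L => μ (a ⁻¹' ↑s)) atTop (𝓝 1) := by
    have h : Tendsto (fun s : Finset L => ∑ l ∈ s, μ (a ⁻¹' {l})) atTop (𝓝 1) := h1
    simpa only [h2] using h
  have h4 := ((ENNReal.tendsto_toReal ENNReal.one_ne_top).comp h3).const_sub 1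
  rw [ENNReal.toReal_one, sub_self] at h4
  obtain ⟨s, hs⟩ := (h4.eventually_lt_const hτ).exists
  refine ⟨s, ?_⟩
  rw [Set.preimage_compl, measureReal_compl (ha s.countable_toSet.measurableSet)]
  rw [probReal_univ]
  exact hs

theorem integral_le_of_le_on {g : X → ℝ} (hg : Measurable g) (hg0 : ∀ x, 0 ≤ g x)
    (hg1 : ∀ x, g x ≤ 1) {s : Set X} (hs : MeasurableSet s) {c : ℝ} (hc : 0 ≤ c)
    (h : ∀ x ∈ s, g x ≤ c) : ∫ x, g x ∂μ ≤ c + μ.real sᶜ := by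
  have hi : Integrable g μ := Integrable.of_bound hg.aestronglyMeasurable 1
    (Eventually.of_forall fun x => by rw [Real.norm_of_nonneg (hg0 x)]; exact hg1 x)
  have hi' : Integrable (sᶜ.indicator fun _ => (1 : ℝ)) μ :=
    (integrable_const 1).indicator hs.compl
  calc ∫ x, g x ∂μ ≤ ∫ x, (c + sᶜ.indicator (fun _ => (1 : ℝ)) x) ∂μ := by
        refine integral_mono hi ((integrable_const c).add hi') fun x => ?_
        by_cases hx : x ∈ s
        · simpa [hx] using h x hx
        · simpa [hx] using (hg1 x).trans (le_add_of_nonneg_left hc)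
    _ = c + μ.real sᶜ := by
        rw [integral_add (integrable_const c) hi', integral_indicator_const _ hs.compl]
        simp

/-- Follows `q⁻¹A`, `q⁻¹F`, `r⁻¹F`, `r⁻¹A'`, `F'`, `B`. In use, `A` and `A'` are sections at a point
and at the representative of its label, with common approximations `F` and `F'`. -/
theorem symmDiff_preimage_chain {q r : X → X} (hq : MeasurePreserving q μ μ)
    (hr : MeasurePreserving r μ μ) {A A' F : Set X} (B F' : Set X) (hA : MeasurableSet A)
    (hA' : MeasurableSet A') (hF : MeasurableSet F) :
    μ.real ((q ⁻¹' A) ∆ B) ≤ μ.real (A ∆ F) + μ.real ((q ⁻¹' F) ∆ (r ⁻¹' F)) +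
      μ.real (A' ∆ F) + μ.real ((r ⁻¹' A') ∆ F') + μ.real (B ∆ F') := by
  have h1 := measureReal_symmDiff_le (μ := μ) (s := q ⁻¹' A) (t := q ⁻¹' F) B
  have h2 := measureReal_symmDiff_le (μ := μ) (s := q ⁻¹' F) (t := r ⁻¹' F) B
  have h3 := measureReal_symmDiff_le (μ := μ) (s := r ⁻¹' F) (t := r ⁻¹' A') B
  have h4 := measureReal_symmDiff_le (μ := μ) (s := r ⁻¹' A') (t := F') B
  rw [← Set.preimage_symmDiff, hq.measureReal_preimage (hA.symmDiff hF).nullMeasurableSet] at h1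
  rw [← Set.preimage_symmDiff, hr.measureReal_preimage (hF.symmDiff hA').nullMeasurableSet,
    symmDiff_comm F] at h3
  rw [symmDiff_comm F' B] at h4
  linarith

omit [IsProbabilityMeasure μ] in
theorem MeasurableFamily.exists_of_label {L : Type*} [Countable L] [MeasurableSpace L]
    [MeasurableSingletonClass L] {a : X → L} (ha : Measurable a) (Q : L → Transformation μ) :
    ∃ T : MeasurableFamily μ, ∀ x, T.fiber x = Q (a x) := by
  have h : Measurable fun p : X × X => (p.2, a p.1) :=
    measurable_snd.prodMk (ha.comp measurable_fst)
  have h1 : Measurable fun p : X × L => (Q p.2).toEquiv p.1 :=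
    measurable_from_prod_countable_left fun l => (Q l).toEquiv.measurable
  have h2 : Measurable fun p : X × L => (Q p.2).toEquiv.symm p.1 :=
    measurable_from_prod_countable_left fun l => (Q l).toEquiv.symm.measurable
  exact ⟨⟨fun x => Q (a x), h1.comp h, h2.comp h⟩, fun x => rfl⟩

end Labels
-- Density of extensions with small deviation
section Density

variable {X : Type*} [MeasurableSpace X] {μ : Measure X}

theorem measurableField_comp {ι : Type*} [Countable ι] [MeasurableSpace ι]
    [MeasurableSingletonClass ι] {m : X → ι} (hm : Measurable m) (P : ι → AdmissibleFunction) :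
    MeasurableField fun x => P (m x) :=
  ⟨(measurable_of_countable fun i => (P i).c).comp hm,
    fun k => (measurable_of_countable fun i => (P i).coeff k).comp hm⟩

variable [StandardBorelSpace X] [IsProbabilityMeasure μ] [NullSingletonClass μ]

/-- The label of `x` holds its cell and approximants of the sections at `x` of `B j` and of its
preimages under `R₀` and its inverse. For equal labels the fibres of `T₀` act on these sections
alike up to small errors, so one perturbation of a representative fibre serves a whole label. Five
errors `τ` come from the chain and one from the uncovered labels. -/
theorem exists_near_family_deviation_le {J κ : Type*} [Finite J] [Finite κ] {B : J → Set (X × X)}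
    (hB : ∀ j, MeasurableSet (B j)) {E : κ → Set X} (hE : ∀ a, MeasurableSet (E a))
    {ι : Type*} [Countable ι] [MeasurableSpace ι] [MeasurableSingletonClass ι] {m : X → ι}
    (hm : Measurable m) (P : ι → AdmissibleFunction) (T₀ : MeasurableFamily μ) {τ : ℝ}
    (hτ : 0 < τ) :
    ∃ n₀ : ℕ, ∀ n ≥ n₀, ∃ T : MeasurableFamily μ,
      (∀ j, (μ.prod μ).real (((skewProduct (Transformation.id μ) T).toEquiv ⁻¹' B j) ∆
          ((skewProduct (Transformation.id μ) T₀).toEquiv ⁻¹' B j)) ≤ 6 * τ ∧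
        (μ.prod μ).real (((skewProduct (Transformation.id μ) T).toEquiv.symm ⁻¹' B j) ∆
          ((skewProduct (Transformation.id μ) T₀).toEquiv.symm ⁻¹' B j)) ≤ 6 * τ) ∧
      ∀ a b, ∫ x, deviation (fun x => P (m x)) T n (E a) (E b) x ∂μ ≤ 2 * τ := by
  classical
  obtain ⟨𝒜, h𝒜c, h𝒜⟩ := exists_countable_measureDense μ
  obtain ⟨F, rfl⟩ := h𝒜c.exists_eq_range h𝒜.nonempty
  have hFm : ∀ k, MeasurableSet (F k) := fun k => h𝒜.measurable _ ⟨k, rfl⟩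
  let R₀ := skewProduct (Transformation.id μ) T₀
  choose α₁ hα₁ hα₁' using fun j => exists_measurable_section_index h𝒜 (hB j) hτ
  choose α₂ hα₂ hα₂' using fun j =>
    exists_measurable_section_index h𝒜 (R₀.toEquiv.measurable (hB j)) hτ
  choose α₃ hα₃ hα₃' using fun j =>
    exists_measurable_section_index h𝒜 (R₀.toEquiv.symm.measurable (hB j)) hτ
  let lab : X → ι × (J → ℕ × ℕ × ℕ) := fun x => (m x, fun j => (α₁ j x, α₂ j x, α₃ j x))
  have hlab : Measurable lab := hm.prodMk (measurable_pi_lambda _ fun j =>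
    (hα₁ j).prodMk ((hα₂ j).prodMk (hα₃ j)))
  obtain ⟨s, hs⟩ := exists_finset_labels (μ := μ) hlab hτ
  have : Nonempty X := μ.nonempty_of_neZero
  let rep : ι × (J → ℕ × ℕ × ℕ) → X := Function.invFun lab
  have hrep : ∀ x, lab (rep (lab x)) = lab x := fun x => Function.invFun_eq ⟨x, rfl⟩
  choose N hN using fun l : ι × (J → ℕ × ℕ × ℕ) =>
    exists_transformation_near_correlation (T₀.fiber (rep l)) (P l.1)
      (H := Sum.elim E fun j => F (l.2 j).1) (by
        rintro (a | j)
        · exact hE a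
        · exact hFm _) hτ
  -- The threshold must serve all labels in use, hence the restriction to the finite set `s`; the
  -- others get the identity.
  refine ⟨s.sup N, fun n hn => ?_⟩
  have hQ : ∀ l, ∃ Q : Transformation μ, l ∈ s →
      (∀ j, μ.real ((Q.toEquiv '' F (l.2 j).1) ∆ ((T₀.fiber (rep l)).toEquiv '' F (l.2 j).1)) < τ ∧
        μ.real ((Q.toEquiv ⁻¹' F (l.2 j).1) ∆ ((T₀.fiber (rep l)).toEquiv ⁻¹' F (l.2 j).1)) < τ) ∧
      ∀ a b, |μ.real (Q.toEquiv^[n] ⁻¹' E a ∩ E b) -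
        (P l.1).correlation μ Q.toEquiv (E a) (E b)| < τ := by
    intro l
    by_cases hl : l ∈ s
    · obtain ⟨Q, h1, h2⟩ := hN l n ((Finset.le_sup hl).trans hn)
      exact ⟨Q, fun _ => ⟨fun j => h1 (Sum.inr j), fun a b => h2 (Sum.inl a) (Sum.inl b)⟩⟩
    · exact ⟨Transformation.id μ, fun h => absurd h hl⟩
  choose Q hQ using hQ
  obtain ⟨T, hT⟩ := MeasurableFamily.exists_of_label hlab Q
  have hsm : MeasurableSet (lab ⁻¹' (s : Set _)) := hlab s.countable_toSet.measurableSet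
  have hsc : μ.real (lab ⁻¹' (s : Set _))ᶜ < τ := hs
  have hm1 : ∀ x, (lab x).1 = m x := fun x => rfl
  have hA : ∀ x j, MeasurableSet (Prod.mk x ⁻¹' B j) := fun x j => measurable_prodMk_left (hB j)
  refine ⟨T, fun j => ⟨?_, ?_⟩, fun a b => ?_⟩
  · have hmeas : MeasurableSet (((skewProduct (Transformation.id μ) T).toEquiv ⁻¹' B j) ∆
        ((skewProduct (Transformation.id μ) T₀).toEquiv ⁻¹' B j)) :=
      ((skewProduct (Transformation.id μ) T).toEquiv.measurable (hB j)).symmDiff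
        ((skewProduct (Transformation.id μ) T₀).toEquiv.measurable (hB j))
    rw [prod_real_eq_integral hmeas]
    refine (integral_le_of_le_on (c := 5 * τ) (measurable_measureReal_prodMk hmeas)
      (fun x => measureReal_nonneg) (fun x => measureReal_le_one) hsm (by positivity)
      fun x hx => ?_).trans (by linarith)
    have hl1 : (rep (lab x) |> α₁ j) = α₁ j x := congrArg (fun l => (l.2 j).1) (hrep x)
    have hl2 : (rep (lab x) |> α₂ j) = α₂ j x := congrArg (fun l => (l.2 j).2.1) (hrep x)
    have h1 := symmDiff_preimage_chain (μ := μ) (Q (lab x)).measurePreserving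
      (T₀.fiber (rep (lab x))).measurePreserving
      (Prod.mk x ⁻¹' (R₀.toEquiv ⁻¹' B j)) (F (α₂ j x)) (hA x j) (hA (rep (lab x)) j)
      (hFm (α₁ j x))
    have e1 := hα₁' j x
    have e2 := ((hQ (lab x) hx).1 j).2
    have e3 := hα₁' j (rep (lab x))
    have e4 := hα₂' j (rep (lab x))
    have e5 := hα₂' j x
    rw [hl1] at e3
    rw [hl2] at e4
    have h2 : Prod.mk x ⁻¹' ((skewProduct (Transformation.id μ) T).toEquiv ⁻¹' B j) =
        (Q (lab x)).toEquiv ⁻¹' (Prod.mk x ⁻¹' B j) := by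
      rw [← hT x]; rfl
    rw [Set.preimage_symmDiff, h2]
    refine h1.trans ?_
    change μ.real _ < τ at e4
    have e2' : μ.real (((Q (lab x)).toEquiv ⁻¹' F (α₁ j x)) ∆
      ((T₀.fiber (rep (lab x))).toEquiv ⁻¹' F (α₁ j x))) < τ := e2
    have e4' : μ.real (((T₀.fiber (rep (lab x))).toEquiv ⁻¹' (Prod.mk (rep (lab x)) ⁻¹' B j)) ∆
      F (α₂ j x)) < τ := e4
    linarith
  · have hmeas : MeasurableSet (((skewProduct (Transformation.id μ) T).toEquiv.symm ⁻¹' B j) ∆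
        ((skewProduct (Transformation.id μ) T₀).toEquiv.symm ⁻¹' B j)) :=
      ((skewProduct (Transformation.id μ) T).toEquiv.symm.measurable (hB j)).symmDiff
        ((skewProduct (Transformation.id μ) T₀).toEquiv.symm.measurable (hB j))
    rw [prod_real_eq_integral hmeas]
    refine (integral_le_of_le_on (c := 5 * τ) (measurable_measureReal_prodMk hmeas)
      (fun x => measureReal_nonneg) (fun x => measureReal_le_one) hsm (by positivity)
      fun x hx => ?_).trans (by linarith)
    have hl1 : (rep (lab x) |> α₁ j) = α₁ j x := congrArg (fun l => (l.2 j).1) (hrep x)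
    have hl3 : (rep (lab x) |> α₃ j) = α₃ j x := congrArg (fun l => (l.2 j).2.2) (hrep x)
    have h1 := symmDiff_preimage_chain (μ := μ) (Q (lab x)).measurePreserving_symm
      (T₀.fiber (rep (lab x))).measurePreserving_symm
      (Prod.mk x ⁻¹' (R₀.toEquiv.symm ⁻¹' B j)) (F (α₃ j x)) (hA x j) (hA (rep (lab x)) j)
      (hFm (α₁ j x))
    have e1 := hα₁' j x
    have e2 := ((hQ (lab x) hx).1 j).1
    have e3 := hα₁' j (rep (lab x))
    have e4 := hα₃' j (rep (lab x))
    have e5 := hα₃' j x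
    rw [hl1] at e3
    rw [hl3] at e4
    rw [MeasurableEquiv.image_eq_preimage_symm, MeasurableEquiv.image_eq_preimage_symm] at e2
    have h2 : Prod.mk x ⁻¹' ((skewProduct (Transformation.id μ) T).toEquiv.symm ⁻¹' B j) =
        (Q (lab x)).toEquiv.symm ⁻¹' (Prod.mk x ⁻¹' B j) := by
      rw [← hT x]; rfl
    rw [Set.preimage_symmDiff, h2]
    refine h1.trans ?_
    have e2' : μ.real (((Q (lab x)).toEquiv.symm ⁻¹' F (α₁ j x)) ∆
      ((T₀.fiber (rep (lab x))).toEquiv.symm ⁻¹' F (α₁ j x))) < τ := e2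
    have e4' : μ.real (((T₀.fiber (rep (lab x))).toEquiv.symm ⁻¹'
      (Prod.mk (rep (lab x)) ⁻¹' B j)) ∆ F (α₃ j x)) < τ := e4
    linarith
  · refine (integral_le_of_le_on (c := τ)
      ((measurableField_comp hm P).measurable_deviation T n (hE a) (hE b))
      (deviation_nonneg _ T n (E a) (E b)) (deviation_le_one _ T n (E a) (E b)) hsm hτ.le
      fun x hx => ?_).trans (by linarith)
    unfold deviation
    rw [hT x]
    exact ((hQ (lab x) hx).2 a b).le

/-- Control the first `k` sets of `D` within a multiple of `1 / (k + 1)` and let `k` grow: the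
metric distance tends to zero. -/
theorem exists_near_family_deviation_lt {D : ℕ → Set (X × X)}
    (hD : (μ.prod μ).MeasureDense (Set.range D)) {κ : Type*} [Finite κ]
    {E : κ → Set X} (hE : ∀ a, MeasurableSet (E a))
    {ι : Type*} [Countable ι] [MeasurableSpace ι] [MeasurableSingletonClass ι] {m : X → ι}
    (hm : Measurable m) (P : ι → AdmissibleFunction) (T₀ : MeasurableFamily μ) {n : ℕ → ℕ}
    (hn : Tendsto n atTop atTop) (N : ℕ) {ε η : ℝ} (hε : 0 < ε) (hη : 0 < η) :
    ∃ T : MeasurableFamily μ, halmosPreDist D (skewProduct (Transformation.id μ) T)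
        (skewProduct (Transformation.id μ) T₀) < ε ∧
      ∃ j ≥ N, ∀ a b, ∫ x, deviation (fun x => P (m x)) T (n j) (E a) (E b) x ∂μ < η := by
  have hDm : ∀ i, MeasurableSet (D i) := fun i => hD.measurable _ ⟨i, rfl⟩
  have h1 : ∀ k : ℕ, ∃ T : MeasurableFamily μ,
      (∀ i : Fin k, (μ.prod μ).real (((skewProduct (Transformation.id μ) T).toEquiv ⁻¹' D i) ∆
          ((skewProduct (Transformation.id μ) T₀).toEquiv ⁻¹' D i)) ≤ 6 * (1 / (k + 1 : ℝ)) ∧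
        (μ.prod μ).real (((skewProduct (Transformation.id μ) T).toEquiv.symm ⁻¹' D i) ∆
          ((skewProduct (Transformation.id μ) T₀).toEquiv.symm ⁻¹' D i)) ≤
            6 * (1 / (k + 1 : ℝ))) ∧
      ∃ j ≥ N, ∀ a b, ∫ x, deviation (fun x => P (m x)) T (n j) (E a) (E b) x ∂μ ≤
        2 * (1 / (k + 1 : ℝ)) := by
    intro k
    obtain ⟨n₀, h⟩ := exists_near_family_deviation_le (B := fun i : Fin k => D i)
      (fun i => hDm i) hE hm P T₀ (τ := 1 / (k + 1 : ℝ)) (by positivity)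
    obtain ⟨j, hj, hjN⟩ := ((hn.eventually_ge_atTop n₀).and (eventually_ge_atTop N)).exists
    obtain ⟨T, hT1, hT2⟩ := h (n j) hj
    exact ⟨T, hT1, j, hjN, hT2⟩
  choose T hT j hj hdev using h1
  have hlim : ∀ c : ℝ, Tendsto (fun k : ℕ => c * (1 / (k + 1 : ℝ))) atTop (𝓝 0) := fun c => by
    simpa using tendsto_one_div_add_atTop_nhds_zero_nat.const_mul c
  have hdist : Tendsto (fun k => halmosPreDist D (skewProduct (Transformation.id μ) (T k))
      (skewProduct (Transformation.id μ) T₀)) atTop (𝓝 0) := by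
    refine (tendsto_halmosPreDist_iff hD).2 ⟨preimagesMerge_of_dense hD
      (fun k => (skewProduct (Transformation.id μ) (T k)).measurePreserving)
      (fun _ => (skewProduct (Transformation.id μ) T₀).measurePreserving)
      (Set.forall_mem_range.2 fun i => ?_), preimagesMerge_of_dense hD
      (fun k => (skewProduct (Transformation.id μ) (T k)).measurePreserving_symm)
      (fun _ => (skewProduct (Transformation.id μ) T₀).measurePreserving_symm)
      (Set.forall_mem_range.2 fun i => ?_)⟩
    · refine squeeze_zero' (Eventually.of_forall fun k => measureReal_nonneg) ?_ (hlim 6)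
      filter_upwards [eventually_gt_atTop i] with k hk using (hT k ⟨i, hk⟩).1
    · refine squeeze_zero' (Eventually.of_forall fun k => measureReal_nonneg) ?_ (hlim 6)
      filter_upwards [eventually_gt_atTop i] with k hk using (hT k ⟨i, hk⟩).2
  obtain ⟨k, hk1, hk2⟩ :=
    ((hdist.eventually_lt_const hε).and ((hlim 2).eventually_lt_const hη)).exists
  exact ⟨T k, hk1, j k, hj k, fun a b => (hdev k a b).trans_lt hk2⟩

end Density
-- From correlations of sets to weak operator convergence
section MatrixCoefficients

variable {X : Type*} [MeasurableSpace X]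

/-- The indicator function of `E` in `L²(μ)`. -/
noncomputable def indicatorL2 (μ : Measure X) [IsFiniteMeasure μ] {E : Set X}
    (hE : MeasurableSet E) : Lp ℂ 2 μ :=
  indicatorConstLp 2 hE (measure_ne_top μ E) 1

variable {μ : Measure X}

theorem inner_indicatorL2 [IsFiniteMeasure μ] {E F : Set X} (hE : MeasurableSet E)
    (hF : MeasurableSet F) :
    inner ℂ (indicatorL2 μ hE) (indicatorL2 μ hF) = (μ.real (E ∩ F) : ℂ) := by
  unfold indicatorL2
  rw [L2.inner_indicatorConstLp_indicatorConstLp]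
  simp

theorem norm_koopman_pow_le (T : Transformation μ) (i : ℕ) : ‖koopman T ^ i‖ ≤ 1 := by
  refine ContinuousLinearMap.opNorm_le_bound _ zero_le_one fun f => ?_
  rw [one_mul]
  induction i generalizing f with
  | zero => simp
  | succ i ih =>
    rw [pow_succ, mul_apply_eq_comp]
    exact (ih _).trans_eq
      ((Lp.compMeasurePreservingₗᵢ ℂ T.toEquiv T.measurePreserving).norm_map f)

theorem koopman_pow_indicatorL2 [IsFiniteMeasure μ] (T : Transformation μ) (i : ℕ) {E : Set X}
    (hE : MeasurableSet E) :
    (koopman T ^ i) (indicatorL2 μ hE) =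
      indicatorL2 μ (T.toEquiv.measurable.iterate i hE) := by
  induction i generalizing E with
  | zero => simp
  | succ i ih =>
    rw [pow_succ', mul_apply_eq_comp, ih hE]
    rfl

theorem projConst_indicatorL2 [IsProbabilityMeasure μ] {E : Set X} (hE : MeasurableSet E) :
    projConst μ (indicatorL2 μ hE) = (μ.real E : ℂ) • indicatorL2 μ MeasurableSet.univ := by
  have h1 : (Lp.const 2 μ (1 : ℂ)) = indicatorL2 μ MeasurableSet.univ := by
    unfold indicatorL2
    rw [indicatorConstLp_univ]
  have h2 : ‖Lp.const 2 μ (1 : ℂ)‖ = 1 := by simp [Lp.norm_const']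
  unfold projConst
  rw [Submodule.starProjection_unit_singleton ℂ h2, h1, inner_indicatorL2, Set.univ_inter]

theorem inner_eval_koopman_indicatorL2 [IsProbabilityMeasure μ] (P : AdmissibleFunction)
    (T : Transformation μ) {E F : Set X} (hE : MeasurableSet E) (hF : MeasurableSet F) :
    inner ℂ (indicatorL2 μ hF) (P.eval (koopman T) (indicatorL2 μ hE)) =
      (P.correlation μ T.toEquiv E F : ℂ) := by
  have h1 := (((P.summable T).hasSum.mapL
    (ContinuousLinearMap.apply ℂ (Lp ℂ 2 μ) (indicatorL2 μ hE))).mapL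
      (innerSL ℂ (indicatorL2 μ hF))).tsum_eq
  have h2 : ∀ i : ℕ, innerSL ℂ (indicatorL2 μ hF)
      (ContinuousLinearMap.apply ℂ (Lp ℂ 2 μ) (indicatorL2 μ hE)
        ((P.coeff i : ℂ) • koopman T ^ i)) =
      ((P.coeff i * μ.real (T.toEquiv^[i] ⁻¹' E ∩ F) : ℝ) : ℂ) := fun i => by
    rw [ContinuousLinearMap.apply_apply, smul_apply, koopman_pow_indicatorL2,
      innerSL_apply_apply, inner_smul_right, inner_indicatorL2, Set.inter_comm]
    push_cast
    rfl
  simp only [h2] at h1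
  rw [← Complex.ofReal_tsum] at h1
  unfold AdmissibleFunction.eval AdmissibleFunction.correlation
  rw [add_apply, inner_add_right, smul_apply,
    inner_smul_right, projConst_indicatorL2, inner_smul_right, inner_indicatorL2, Set.inter_univ]
  push_cast [h1]
  rfl

theorem eq_top_of_indicatorL2_mem [IsFiniteMeasure μ] {W : Submodule ℂ (Lp ℂ 2 μ)}
    (hW : IsClosed (W : Set (Lp ℂ 2 μ))) {𝒜 : Set (Set X)} (h𝒜 : μ.MeasureDense 𝒜)
    (h : ∀ s (hs : s ∈ 𝒜), indicatorL2 μ (h𝒜.measurable s hs) ∈ W) : W = ⊤ := by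
  have : Fact ((2 : ℝ≥0∞) ≠ ∞) := ⟨ENNReal.ofNat_ne_top⟩
  have h1 : ∀ s (hs : MeasurableSet s), indicatorL2 μ hs ∈ W := fun s hs => by
    have h2 := h𝒜.indicatorConstLp_subset_closure 2 (1 : ℂ) ⟨s, hs, measure_ne_top μ s, rfl⟩
    refine closure_minimal ?_ hW h2
    rintro _ ⟨t, ht, _, rfl⟩
    exact h t ht
  rw [Submodule.eq_top_iff']
  refine Lp.induction (by simp) _ (fun c s hs hμs => ?_) (fun f g hf hg _ hf' hg' => ?_) hW
  · have h3 : (Lp.simpleFunc.indicatorConst 2 hs hμs.ne c : Lp ℂ 2 μ) = c • indicatorL2 μ hs := by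
      rw [Lp.simpleFunc.coe_indicatorConst, indicatorL2, indicatorConstLp,
        indicatorConstLp, ← MemLp.toLp_const_smul]
      congr 1
      ext x
      by_cases hx : x ∈ s <;> simp [hx]
    rw [h3]
    exact W.smul_mem _ (h1 s hs)
  · exact W.add_mem hf' hg'

/-- The uniform bound makes the vectors with limit zero a closed subspace, and the indicators of a
dense family span a dense one. -/
theorem tendsto_zero_of_indicatorL2 [IsFiniteMeasure μ] {L : ℕ → Lp ℂ 2 μ →L[ℂ] ℂ} {C : ℝ}
    (hL : ∀ k, ‖L k‖ ≤ C) {𝒜 : Set (Set X)} (h𝒜 : μ.MeasureDense 𝒜)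
    (h : ∀ s (hs : s ∈ 𝒜),
      Tendsto (fun k => L k (indicatorL2 μ (h𝒜.measurable s hs))) atTop (𝓝 0)) (f : Lp ℂ 2 μ) :
    Tendsto (fun k => L k f) atTop (𝓝 0) := by
  let W : Submodule ℂ (Lp ℂ 2 μ) :=
    { carrier := {f | Tendsto (fun k => L k f) atTop (𝓝 0)}
      add_mem' := fun {a b} ha hb => by
        simpa using Tendsto.add (Set.mem_ofPred.1 ha) (Set.mem_ofPred.1 hb)
      zero_mem' := by simp
      smul_mem' := fun c a ha => by simpa using Tendsto.const_mul c (Set.mem_ofPred.1 ha) }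
  have hC : 0 ≤ C := (norm_nonneg _).trans (hL 0)
  have hW : IsClosed (W : Set (Lp ℂ 2 μ)) := by
    refine isClosed_of_closure_subset fun a ha => ?_
    change Tendsto (fun k => L k a) atTop (𝓝 0)
    rw [Metric.tendsto_nhds]
    intro ε hε
    obtain ⟨b, hb, hab⟩ := Metric.mem_closure_iff.1 ha (ε / 2 / (C + 1)) (by positivity)
    filter_upwards [Metric.tendsto_nhds.1 (show Tendsto (fun k => L k b) atTop (𝓝 0) from hb)
      (ε / 2) (by positivity)] with k hk
    rw [dist_zero_right] at hk ⊢
    rw [dist_eq_norm, lt_div_iff₀ (by positivity)] at hab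
    have h1 : ‖L k (a - b)‖ ≤ C * ‖a - b‖ :=
      ((L k).le_opNorm _).trans (mul_le_mul_of_nonneg_right (hL k) (norm_nonneg _))
    have h2 : L k a = L k (a - b) + L k b := by rw [map_sub, sub_add_cancel]
    have h3 := norm_add_le (L k (a - b)) (L k b)
    rw [h2]
    nlinarith [norm_nonneg (a - b)]
  have := eq_top_of_indicatorL2_mem hW h𝒜 h
  exact (this ▸ Submodule.mem_top : f ∈ W)

theorem weaklyConverges_of_correlation [IsProbabilityMeasure μ] {𝒜 : Set (Set X)}
    (h𝒜 : μ.MeasureDense 𝒜) (P : AdmissibleFunction) (T : Transformation μ) (N : ℕ → ℕ)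
    (h : ∀ E ∈ 𝒜, ∀ F ∈ 𝒜, Tendsto (fun k => μ.real (T.toEquiv^[N k] ⁻¹' E ∩ F)) atTop
      (𝓝 (P.correlation μ T.toEquiv E F))) :
    WeaklyConverges (fun k => koopman T ^ N k) (P.eval (koopman T)) := by
  let Z : ℕ → Lp ℂ 2 μ →L[ℂ] Lp ℂ 2 μ := fun k => koopman T ^ N k - P.eval (koopman T)
  have hZ : ∀ k, ‖Z k‖ ≤ 1 + ‖P.eval (koopman T)‖ := fun k =>
    (norm_sub_le _ _).trans (by gcongr; exact norm_koopman_pow_le T _)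
  -- The density argument is applied twice: here in `f` for a fixed indicator, then in `g` for a
  -- fixed `f`.
  have h1 : ∀ F (hF : F ∈ 𝒜) f, Tendsto (fun k =>
      inner ℂ (indicatorL2 μ (h𝒜.measurable F hF)) (Z k f)) atTop (𝓝 0) := by
    intro F hF
    refine tendsto_zero_of_indicatorL2
      (L := fun k => (innerSL ℂ (indicatorL2 μ (h𝒜.measurable F hF))).comp (Z k))
      (C := ‖indicatorL2 μ (h𝒜.measurable F hF)‖ * (1 + ‖P.eval (koopman T)‖))
      (fun k => ?_) h𝒜 fun E hE => ?_
    · refine (ContinuousLinearMap.opNorm_comp_le _ _).trans ?_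
      rw [innerSL_apply_norm]
      gcongr
      exact hZ k
    · have h2 : ∀ k, ((innerSL ℂ (indicatorL2 μ (h𝒜.measurable F hF))).comp (Z k))
          (indicatorL2 μ (h𝒜.measurable E hE)) =
          ((μ.real (T.toEquiv^[N k] ⁻¹' E ∩ F) - P.correlation μ T.toEquiv E F : ℝ) : ℂ) := by
        intro k
        rw [ContinuousLinearMap.comp_apply, innerSL_apply_apply, sub_apply,
          inner_sub_right, inner_eval_koopman_indicatorL2, koopman_pow_indicatorL2,
          inner_indicatorL2, Set.inter_comm]
        push_cast
        rfl
      simp only [h2]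
      have := (h E hE F hF).sub_const (P.correlation μ T.toEquiv E F)
      rw [sub_self] at this
      exact (Complex.continuous_ofReal.tendsto' 0 0 Complex.ofReal_zero).comp this
  intro f g
  have h3 := tendsto_zero_of_indicatorL2 (L := fun k => innerSL ℂ (Z k f))
    (C := (1 + ‖P.eval (koopman T)‖) * ‖f‖) (fun k => by
      rw [innerSL_apply_norm]
      exact ((Z k).le_opNorm f).trans (by gcongr; exact hZ k)) h𝒜 (fun F hF => by
      have := (h1 F hF f).norm
      rw [norm_zero] at this
      refine tendsto_zero_iff_norm_tendsto_zero.2 (this.congr fun k => ?_)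
      rw [innerSL_apply_apply, norm_inner_symm]) g
  have h4 := h3.add_const (inner ℂ (P.eval (koopman T) f) g)
  rw [zero_add] at h4
  refine h4.congr fun k => ?_
  rw [innerSL_apply_apply, ← inner_add_left]
  simp [Z]

end MatrixCoefficients

/-! ### Summable integrals and almost everywhere convergence -/

section AlmostEverywhere

variable {α : Type*} [MeasurableSpace α] {μ : Measure α}

/-- The sum of the functions from `K` on has finite integral, so it is finite almost everywhere and
its terms tend to zero. -/
theorem ae_tendsto_zero_of_integral_lt {g : ℕ → α → ℝ} (hg0 : ∀ k x, 0 ≤ g k x)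
    (hg : ∀ k, Integrable (g k) μ) {K : ℕ} (h : ∀ k ≥ K, ∫ x, g k x ∂μ < (1 / 2) ^ k) :
    ∀ᵐ x ∂μ, Tendsto (fun k => g k x) atTop (𝓝 0) := by
  have h1 : ∫⁻ x, ∑' k, ENNReal.ofReal (g (k + K) x) ∂μ ≠ ∞ := by
    rw [lintegral_tsum fun k => (hg _).aestronglyMeasurable.aemeasurable.ennreal_ofReal]
    have h2 : Summable fun k : ℕ => (1 / 2 : ℝ) ^ (k + K) :=
      (summable_nat_add_iff K).2 summable_geometric_two
    refine ne_top_of_le_ne_top (h2.tsum_ofReal_ne_top) (ENNReal.tsum_le_tsum fun k => ?_)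
    rw [← ofReal_integral_eq_lintegral_ofReal (hg _) (Eventually.of_forall (hg0 _))]
    exact ENNReal.ofReal_le_ofReal (h _ (by omega)).le
  have h3 := ae_lt_top' (AEMeasurable.tsum fun k =>
    (hg (k + K)).aestronglyMeasurable.aemeasurable.ennreal_ofReal) h1
  filter_upwards [h3] with x hx
  have h4 := ENNReal.tendsto_atTop_zero_of_tsum_ne_top hx.ne
  have h5 := (ENNReal.tendsto_toReal ENNReal.zero_ne_top).comp h4
  rw [← tendsto_add_atTop_iff_nat K]
  refine h5.congr fun k => ?_
  exact ENNReal.toReal_ofReal (hg0 _ _)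

end AlmostEverywhere
-- The dense `G_δ` set and the subsequence
section Typical

variable {X : Type*} [MeasurableSpace X] {μ : Measure X} [IsProbabilityMeasure μ]

/-- A point of the space determines its family only up to null sets. Families with the same point
are at distance zero, so continuity along a constant sequence identifies the integrals. -/
theorem integral_deviation_congr {D : ℕ → Set (X × X)}
    (hD : (μ.prod μ).MeasureDense (Set.range D)) {P : X → AdmissibleFunction}
    (hP : MeasurableField P) {S T : MeasurableFamily μ}
    (h : toExt (Transformation.id μ) S = toExt (Transformation.id μ) T) (n : ℕ) {E F : Set X}
    (hE : MeasurableSet E) (hF : MeasurableSet F) :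
    ∫ x, deviation P S n E F x ∂μ = ∫ x, deviation P T n E F x ∂μ := by
  let := halmosMetric (μ := μ.prod μ) D
  have h0 : halmosPreDist D (skewProduct (Transformation.id μ) S)
      (skewProduct (Transformation.id μ) T) = 0 :=
    (congrArg (dist · (toExt (Transformation.id μ) T)) h).trans (dist_self _)
  have := tendsto_integral_deviation hD hP (β := ℕ) (l := atTop) (S := fun _ => S) (T := T)
    (by simp [h0]) n hE hF
  exact tendsto_nhds_unique tendsto_const_nhds this

theorem continuous_integral_deviation {D : ℕ → Set (X × X)}
    (hD : (μ.prod μ).MeasureDense (Set.range D)) {P : X → AdmissibleFunction}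
    (hP : MeasurableField P) {rep : Ext (Transformation.id μ) → MeasurableFamily μ}
    (hrep : ∀ e, toExt (Transformation.id μ) (rep e) = e) (n : ℕ) {E F : Set X}
    (hE : MeasurableSet E) (hF : MeasurableSet F) :
    letI := halmosMetric (μ := μ.prod μ) D
    Continuous fun e => ∫ x, deviation P (rep e) n E F x ∂μ := by
  let := halmosMetric (μ := μ.prod μ) D
  refine continuous_iff_continuousAt.2 fun e => ?_
  refine tendsto_integral_deviation hD hP ?_ n hE hF
  have h1 : ∀ b, halmosPreDist D (skewProduct (Transformation.id μ) (rep b))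
      (skewProduct (Transformation.id μ) (rep e)) = dist b e := fun b =>
    show dist (toExt (Transformation.id μ) (rep b)) (toExt (Transformation.id μ) (rep e)) = _ by
      rw [hrep, hrep]
  simp only [h1]
  exact tendsto_iff_dist_tendsto_zero.1 tendsto_id

variable [StandardBorelSpace X] [NullSingletonClass μ]

/-- For each `k` the condition is open by continuity in mean and dense by perturbation; completeness
and Baire's theorem give the intersection. -/
theorem forTypicalExtension_integral_deviation {D : ℕ → Set (X × X)}
    (hD : (μ.prod μ).MeasureDense (Set.range D)) {E : ℕ → Set X} (hE : ∀ a, MeasurableSet (E a))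
    {ι : Type*} [Countable ι] [MeasurableSpace ι] [MeasurableSingletonClass ι] {m : X → ι}
    (hm : Measurable m) (P : ι → AdmissibleFunction) {n : ℕ → ℕ} (hn : Tendsto n atTop atTop) :
    ForTypicalExtension D (Transformation.id μ) fun T : MeasurableFamily μ =>
      ∀ k : ℕ, ∃ j ≥ k, ∀ a b : Fin k,
        ∫ x, deviation (fun x => P (m x)) T (n j) (E a) (E b) x ∂μ < (1 / 2) ^ k := by
  let := halmosMetric (μ := μ.prod μ) D
  have : CompleteSpace (Ext (Transformation.id μ)) := completeSpace_ext_id hD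
  have hP := measurableField_comp hm P
  choose rep hrep using fun e : Ext (Transformation.id μ) => e.2
  have hrep' : ∀ e, toExt (Transformation.id μ) (rep e) = e := fun e => Subtype.ext (hrep e)
  let V : ℕ → Set (Ext (Transformation.id μ)) := fun k => ⋃ j ≥ k, ⋂ a : Fin k, ⋂ b : Fin k,
    {e | ∫ x, deviation (fun x => P (m x)) (rep e) (n j) (E a) (E b) x ∂μ < (1 / 2) ^ k}
  have hV : ∀ k, IsOpen (V k) := fun k =>
    isOpen_biUnion fun j _ => isOpen_iInter_of_finite fun a => isOpen_iInter_of_finite fun b =>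
      isOpen_lt (continuous_integral_deviation hD hP hrep' (n j) (hE a) (hE b)) continuous_const
  have hmem : ∀ k (T : MeasurableFamily μ), toExt (Transformation.id μ) T ∈ V k ↔
      ∃ j ≥ k, ∀ a b : Fin k,
        ∫ x, deviation (fun x => P (m x)) T (n j) (E a) (E b) x ∂μ < (1 / 2) ^ k := by
    intro k T
    simp only [V, Set.mem_iUnion, Set.mem_iInter, Set.mem_ofPred, exists_prop,
      fun (j : ℕ) (a b : Fin k) => integral_deviation_congr hD hP
        (hrep' (toExt (Transformation.id μ) T)) (n j) (hE a) (hE b)]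
  have hVd : ∀ k, Dense (V k) := by
    intro k
    refine Metric.dense_iff.2 fun e r hr => ?_
    obtain ⟨T, hT, hj⟩ := exists_near_family_deviation_lt hD (E := fun a : Fin k => E a)
      (fun a => hE a) hm P (rep e) hn k hr (η := (1 / 2) ^ k) (by positivity)
    refine ⟨toExt (Transformation.id μ) T, ?_, (hmem k T).2 hj⟩
    rw [Metric.mem_ball]
    conv_lhs => rw [← hrep' e]
    exact hT
  exact ⟨⋂ k, V k, IsGδ.iInter_of_isOpen hV, dense_iInter_of_isOpen hV hVd,
    fun T hT k => (hmem k T).1 (Set.mem_iInter.1 hT k)⟩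

omit [StandardBorelSpace X] [NullSingletonClass μ] in
theorem exists_strictMono_ae_tendsto_deviation {E : ℕ → Set X} (hE : ∀ a, MeasurableSet (E a))
    {P : X → AdmissibleFunction} (hP : MeasurableField P) {n : ℕ → ℕ} {T : MeasurableFamily μ}
    (h : ∀ k : ℕ, ∃ j ≥ k, ∀ a b : Fin k,
      ∫ x, deviation P T (n j) (E a) (E b) x ∂μ < (1 / 2) ^ k) :
    ∃ j : ℕ → ℕ, StrictMono j ∧ ∀ᵐ x ∂μ, ∀ a b,
      Tendsto (fun k => deviation P T (n (j k)) (E a) (E b) x) atTop (𝓝 0) := by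
  obtain ⟨j, hj, hjk⟩ := extraction_forall_of_frequently (P := fun k j => ∀ a < k, ∀ b < k,
      ∫ x, deviation P T (n j) (E a) (E b) x ∂μ < (1 / 2) ^ k) fun k => by
    refine frequently_atTop.2 fun N => ?_
    -- The larger index pushes `j` past `N` while only sharpening the bound and enlarging the range
    -- of `a` and `b`.
    obtain ⟨j, hj, hab⟩ := h (max k N)
    refine ⟨j, (le_max_right _ _).trans hj, fun a ha b hb => ?_⟩
    exact (hab ⟨a, ha.trans_le (le_max_left _ _)⟩ ⟨b, hb.trans_le (le_max_left _ _)⟩).trans_le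
      (pow_le_pow_of_le_one (by norm_num) (by norm_num) (le_max_left _ _))
  refine ⟨j, hj, ae_all_iff.2 fun a => ae_all_iff.2 fun b => ?_⟩
  -- The pair `a, b` is controlled once `k` exceeds both.
  exact ae_tendsto_zero_of_integral_lt (K := max a b + 1)
    (fun k => deviation_nonneg P T (n (j k)) (E a) (E b))
    (fun k => hP.integrable_deviation T (n (j k)) (hE a) (hE b))
    fun k hk => hjk k a (by omega) b (by omega)

end Typical
end TypicalExt

/-! ### Conclusion: convergence in almost every fibre -/

theorem mainTheorem9 {X : Type*} [MeasurableSpace X] [StandardBorelSpace X]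
    (μ : MeasureTheory.Measure X) [MeasureTheory.IsProbabilityMeasure μ]
    [MeasureTheory.NullSingletonClass μ]
    (D : ℕ → Set (X × X)) (hD : (μ.prod μ).MeasureDense (Set.range D))
    {ι : Type*} [Countable ι] (A : ι → Set X)
    (hA_meas : ∀ m, MeasurableSet (A m)) (hA_pos : ∀ m, 0 < μ (A m))
    (hA_disj : Pairwise fun m m' => Disjoint (A m) (A m')) (hA_cover : ⋃ m, A m = Set.univ)
    (P : ι → TypicalExt.AdmissibleFunction)
    (n : ℕ → ℕ) (hn : Filter.Tendsto n Filter.atTop Filter.atTop) :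
    TypicalExt.ForTypicalExtension D (TypicalExt.Transformation.id μ)
      fun T : TypicalExt.MeasurableFamily μ =>
        ∃ j : ℕ → ℕ, StrictMono j ∧
          ∀ m, ∀ᵐ x ∂μ, x ∈ A m →
            TypicalExt.WeaklyConverges
              (fun k => TypicalExt.koopman (T.fiber x) ^ n (j k))
              ((P m).eval (TypicalExt.koopman (T.fiber x))) := by
  -- The cell index `m x` turns the functions `P m` into one measurable field over `X`, so a single
  -- subsequence serves all cells.
  choose m hm using fun x => Set.mem_iUnion.1 (hA_cover ▸ Set.mem_univ x : x ∈ ⋃ m, A m)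
  have hmA : ∀ x i, x ∈ A i → m x = i := fun x i hx => by
    by_contra hne
    exact (hA_disj hne).le_bot ⟨hm x, hx⟩
  let : MeasurableSpace ι := ⊤
  have hmm : Measurable m := measurable_to_countable' fun i => by
    have : m ⁻¹' {i} = A i := Set.ext fun x => ⟨fun h => (show m x = i from h) ▸ hm x, hmA x i⟩
    rw [this]
    exact hA_meas i
  obtain ⟨𝒜, h𝒜c, h𝒜⟩ := exists_countable_measureDense μ
  obtain ⟨E, rfl⟩ := h𝒜c.exists_eq_range h𝒜.nonempty
  have hE : ∀ a, MeasurableSet (E a) := fun a => h𝒜.measurable _ ⟨a, rfl⟩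
  obtain ⟨G, hG, hGd, h⟩ := TypicalExt.forTypicalExtension_integral_deviation hD hE hmm P hn
  refine ⟨G, hG, hGd, fun T hT => ?_⟩
  obtain ⟨j, hj, hae⟩ :=
    TypicalExt.exists_strictMono_ae_tendsto_deviation hE
      (TypicalExt.measurableField_comp hmm P) (h T hT)
  refine ⟨j, hj, fun i => ?_⟩
  filter_upwards [hae] with x hx hxi
  refine TypicalExt.weaklyConverges_of_correlation h𝒜 (P i) (T.fiber x) _ ?_
  rintro _ ⟨a, rfl⟩ _ ⟨b, rfl⟩
  have := hx a b
  unfold TypicalExt.deviation at this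
  simp only [hmA x i hxi] at this
  rw [tendsto_iff_dist_tendsto_zero]
  exact this
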